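/- Let $n\ge 3$, let $(M^n,g)$ be a compact connected smooth Riemannian manifold with boundary, let $0\le\theta\le\frac{n-1}{n-2}$ and $\alpha:=\frac{2\theta}{n-1}$, and let $w\in C^\infty(M)$ be positive. Suppose that some boundary point $x\in\partial M$ satisfies $w(x)=\inf_M w=1$. For $v>0$ define the unequally weighted isoperimetric profile $$I(v):=\inf\Big\{\int_{\partial^*E}w^{\theta}\,d\mathcal H^{n-1}\;:\;E\subset M\text{ measurable with finite perimeter, }\int_E w^{\alpha}\,d\mathcal H^{n}=v\Big\}$$ (with value $+\infty$ if there is no such $E$), where perimeter and reduced boundary $\partial^*E$ are relative to the interior $M\setminus\partial M$, so that pieces of the topological boundary of $E$ lying in $\partial M$ do not count, and $\mathcal H^k$ denotes the normalized $k$-dimensional Hausdorff measure of the Riemannian distance (so $\mathcal H^n$ is the Riemannian volume). Then $$\limsup_{v\to0^+}v^{-\frac{n-1}{n}}I(v)\le n\,\mathrm{Vol}(\mathbb B^n_+)^{1/n},$$ where $\mathbb B^n_+$ is the unit half-ball in $\mathbb R^n$. -/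

import Mathlib

open Set Filter Topology MeasureTheory Bundle
open scoped ENNReal ContDiff Manifold

namespace WeightedProfile

noncomputable section

/-- The divergence `∑ᵢ ∂ᵢ Xⁱ` of a vector field on `ℝⁿ`. -/
def divergence {n : ℕ} (X : EuclideanSpace ℝ (Fin n) → EuclideanSpace ℝ (Fin n))
    (y : EuclideanSpace ℝ (Fin n)) : ℝ :=
  ∑ i, (fderiv ℝ X y (EuclideanSpace.single i 1)) i

/-- The (De Giorgi) perimeter `P(F; U)` of `F ⊆ ℝⁿ` in the open set `U`: the supremum of
`∫_F div X` over the `C¹` vector fields `X` with compact support in `U` and `|X| ≤ 1`. -/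
def relPerimeter {n : ℕ} (F U : Set (EuclideanSpace ℝ (Fin n))) : ℝ≥0∞ :=
  ⨆ (X : EuclideanSpace ℝ (Fin n) → EuclideanSpace ℝ (Fin n)) (_ : ContDiff ℝ 1 X)
    (_ : HasCompactSupport X) (_ : tsupport X ⊆ U) (_ : ∀ y, ‖X y‖ ≤ 1),
    ENNReal.ofReal (∫ y in F, divergence X y)

/-- `ν μ` is the Gauss–Green measure of `F ⊆ ℝⁿ` in the open set `U`, in polar form: `μ` is a
finite Borel measure, `ν` a measurable field of unit vectors, and
`∫_F div X = ∫ ⟨X, ν⟩ dμ` for all `C¹` fields `X` with compact support in `U`.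
On `U`, `μ` is the total variation of the distributional gradient of the indicator of `F`. -/
structure IsGaussGreen {n : ℕ} (F U : Set (EuclideanSpace ℝ (Fin n)))
    (μ : Measure (EuclideanSpace ℝ (Fin n)))
    (ν : EuclideanSpace ℝ (Fin n) → EuclideanSpace ℝ (Fin n)) : Prop where
  finite : IsFiniteMeasure μ
  measurable : Measurable ν
  norm_eq_one : ∀ y, ‖ν y‖ = 1
  integral_eq : ∀ X : EuclideanSpace ℝ (Fin n) → EuclideanSpace ℝ (Fin n),
    ContDiff ℝ 1 X → HasCompactSupport X → tsupport X ⊆ U →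
      ∫ y in F, divergence X y = ∫ y, inner ℝ (X y) (ν y) ∂μ

/-- The (De Giorgi) reduced boundary of `F ⊆ ℝⁿ`: the points `q` near which `F` has finite
perimeter, which lie in the support of the perimeter measure `μ`, and at which the averages
`(1 / μ(B_r(q))) ∫_{B_r(q)} ν dμ` converge, as `r → 0`, to a unit vector. -/
def euclideanReducedBoundary {n : ℕ} (F : Set (EuclideanSpace ℝ (Fin n))) :
    Set (EuclideanSpace ℝ (Fin n)) :=
  {q | ∃ r₀ > 0, ∃ (μ : Measure (EuclideanSpace ℝ (Fin n)))
      (ν : EuclideanSpace ℝ (Fin n) → EuclideanSpace ℝ (Fin n)),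
      IsGaussGreen F (Metric.ball q r₀) μ ν ∧ (∀ r > 0, 0 < μ (Metric.ball q r)) ∧
      ∃ ν₀ : EuclideanSpace ℝ (Fin n), ‖ν₀‖ = 1 ∧
        Tendsto (fun r : ℝ => (μ.real (Metric.ball q r))⁻¹ • ∫ y in Metric.ball q r, ν y ∂μ)
          (𝓝[>] 0) (𝓝 ν₀)}

section Manifold

variable {n : ℕ} [NeZero n] {M : Type*} [TopologicalSpace M]
  [ChartedSpace (EuclideanHalfSpace n) M]

/-- The part of `E ⊆ M` in the domain of the chart `e`, read in the half-space
`{y ∈ ℝⁿ | 0 ≤ y₀}` through `e`. -/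
def chartImage (e : OpenPartialHomeomorph M (EuclideanHalfSpace n)) (E : Set M) :
    Set (EuclideanSpace ℝ (Fin n)) :=
  (e.extend (𝓡∂ n)).target ∩ (e.extend (𝓡∂ n)).symm ⁻¹' E

/-- `E ⊆ M` has finite perimeter (relative to the interior of `M`; the part of the boundary of `E`
that lies in `∂M` does not count): around every point of `M`, boundary points included, there is a
smooth chart in which `E` has finite perimeter in the interior points near that point.
For compact `M` this says that the total perimeter of `E` in `M \ ∂M` is finite; it depends
neither on the charts (finite perimeter is invariant under diffeomorphisms) nor on the Riemannian
metric (any two are comparable). -/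
def HasFinitePerimeter (E : Set M) : Prop :=
  ∀ p : M, ∃ e ∈ IsManifold.maximalAtlas (𝓡∂ n) ∞ M, p ∈ e.source ∧ ∃ r > 0,
    relPerimeter (chartImage e E)
      (interior (e.extend (𝓡∂ n)).target ∩ Metric.ball (e.extend (𝓡∂ n) p) r) < (⊤ : ℝ≥0∞)

/-- The reduced boundary `∂*E` of `E ⊆ M` (in `M \ ∂M`): the interior points of `M` that are, in a
smooth chart, points of the reduced boundary (a notion invariant under diffeomorphisms). -/
def reducedBoundary (E : Set M) : Set M :=
  {p | p ∈ (𝓡∂ n).interior M ∧ ∃ e ∈ IsManifold.maximalAtlas (𝓡∂ n) ∞ M, p ∈ e.source ∧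
    e.extend (𝓡∂ n) p ∈ euclideanReducedBoundary (chartImage e E)}

end Manifold

section Profile

/-- `V(E) = ∫_E w^α dℋⁿ`; the normalised `n`-dimensional Hausdorff measure `μHE[n]` of the
Riemannian distance is the Riemannian volume. -/
def weightedVolume (n : ℕ) {M : Type*} [EMetricSpace M] [MeasurableSpace M] [BorelSpace M]
    (α : ℝ) (w : M → ℝ) (E : Set M) : ℝ≥0∞ :=
  ∫⁻ p in E, ENNReal.ofReal (w p ^ α) ∂μHE[n]

/-- `A(E) = ∫_{∂*E} w^θ dℋⁿ⁻¹`. -/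
def weightedArea (n : ℕ) [NeZero n] {M : Type*} [EMetricSpace M] [MeasurableSpace M] [BorelSpace M]
    [ChartedSpace (EuclideanHalfSpace n) M] (θ : ℝ) (w : M → ℝ) (E : Set M) : ℝ≥0∞ :=
  ∫⁻ p in reducedBoundary (n := n) E, ENNReal.ofReal (w p ^ θ) ∂μHE[n - 1]

/-- The unequally weighted isoperimetric profile: with `α = 2θ / (n - 1)`, the infimum of
`∫_{∂*E} w^θ` over the measurable sets `E ⊆ M` of finite perimeter with `∫_E w^α = v`. -/
def profile (n : ℕ) [NeZero n] {M : Type*} [EMetricSpace M] [MeasurableSpace M] [BorelSpace M]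
    [ChartedSpace (EuclideanHalfSpace n) M] (θ : ℝ) (w : M → ℝ) (v : ℝ) : ℝ≥0∞ :=
  ⨅ (E : Set M) (_ : MeasurableSet E) (_ : HasFinitePerimeter (n := n) E)
    (_ : weightedVolume n (2 * θ / ((n : ℝ) - 1)) w E = ENNReal.ofReal v),
    weightedArea n θ w E

end Profile

end

end WeightedProfile

/-!
The competitors for the profile are small half-balls around the boundary point `x`. Take the chart
at `x`, with values in the half-space, followed by a linear map `A` that makes the metric at `x`
the Euclidean one. The boundary point `x` goes to the bounding hyperplane, so that the ball of
radius `r` around `x` in these coordinates is a Euclidean half-ball, bounded in the interior of `M`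
by a half-sphere.

Since the metric is continuous, for every `K > 1` these coordinates are `K`-bi-Lipschitz near `x`
for the Riemannian distance (`exists_nhds_edist_extChartAt_le` and
`exists_ball_edist_extChartAt_symm_le`). Lipschitz maps change Hausdorff measures by controlled
factors, so the half-ball of radius `r` in `M` has volume at least `K⁻ⁿ rⁿ Vol(𝔹ⁿ₊)` and its
half-sphere has area at most `Kⁿ⁻¹ rⁿ⁻¹ n Vol(𝔹ⁿ₊)`. The latter uses that the `(n-1)`-dimensional
Hausdorff measure of a piece of the unit sphere is at most `n` times the volume of the cone over it
(`euclideanHausdorffMeasure_le_volume_unitCone`). The weights are harmless: `w ≥ 1`, and `w` tends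
to `1` at `x`.

A point of the reduced boundary is a point of the topological boundary, because the indicator of a
set has zero gradient inside and outside of it (`reducedBoundary_subset_frontier`); this bounds the
weighted area by the area of the half-sphere. The half-balls have finite perimeter since ellipsoids
do (`relPerimeter_ellipsoid_lt_top`), and their weighted volume depends continuously on the radius,
so every small `v` is attained. Eliminating `r` gives the bound with a power of `K` as an additional
factor (`eventually_profile_le`), and `K` tends to `1`.
-/

namespace WeightedProfile

noncomputable section

open scoped NNReal Pointwise

/-! ### Hausdorff measure of half-spheres and volume of half-balls -/

section Hausdorff

/-- A `K`-Lipschitz map increases the `d`-dimensional Hausdorff measure at most by the factor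
`K ^ d`. -/
lemma _root_.LipschitzOnWith.euclideanHausdorffMeasure_image_le {X Y : Type*}
    [EMetricSpace X] [MeasurableSpace X] [BorelSpace X]
    [EMetricSpace Y] [MeasurableSpace Y] [BorelSpace Y] {K : ℝ≥0} {f : X → Y} {s : Set X}
    (h : LipschitzOnWith K f s) (d : ℕ) : μHE[d] (f '' s) ≤ (K : ℝ≥0∞) ^ d * μHE[d] s := by
  have h1 := h.hausdorffMeasure_image_le (d := d) d.cast_nonneg
  rw [ENNReal.rpow_natCast] at h1
  simp only [Measure.euclideanHausdorffMeasure_def, Measure.smul_apply, ENNReal.smul_def,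
    smul_eq_mul]
  calc _ ≤ _ := mul_le_mul_right h1 _
    _ = _ := by ring

variable {V : Type*} [NormedAddCommGroup V] [InnerProductSpace ℝ V]

/-- The radial projection onto the unit sphere is nonexpansive outside the open unit ball: with `c`
the cosine of the angle between `x` and `y`,
`‖x - y‖² - 2 (1 - c) = (‖x‖ - ‖y‖)² + 2 (‖x‖ ‖y‖ - 1) (1 - c) ≥ 0`. -/
lemma lipschitzOnWith_inv_norm_smul :
    LipschitzOnWith 1 (fun y : V => ‖y‖⁻¹ • y) {y | 1 ≤ ‖y‖} := by
  refine LipschitzOnWith.of_dist_le_mul fun x hx y hy => ?_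
  simp only [mem_ofPred_eq] at hx hy
  rw [NNReal.coe_one, one_mul, dist_eq_norm, dist_eq_norm]
  refine le_of_sq_le_sq ?_ (norm_nonneg _)
  have hx0 : ‖x‖ ≠ 0 := by positivity
  have hy0 : ‖y‖ ≠ 0 := by positivity
  have hxy := real_inner_le_norm x y
  rw [norm_sub_sq_real, norm_sub_sq_real, norm_smul, norm_smul, real_inner_smul_left,
    real_inner_smul_right, norm_inv, norm_inv, norm_norm, norm_norm, inv_mul_cancel₀ hx0,
    inv_mul_cancel₀ hy0]
  have hab : 1 ≤ ‖x‖ * ‖y‖ := one_le_mul_of_one_le_of_one_le hx hy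
  set c := ‖x‖⁻¹ * (‖y‖⁻¹ * inner ℝ x y) with hc
  have hc' : inner ℝ x y = ‖x‖ * ‖y‖ * c := by rw [hc]; field_simp
  have hc1 : c ≤ 1 := by
    rw [hc'] at hxy
    by_contra hcon
    nlinarith
  rw [hc']
  nlinarith [sq_nonneg (‖x‖ - ‖y‖), mul_nonneg (sub_nonneg.2 hab) (sub_nonneg.2 hc1)]

/-- The part in the open unit ball of the cone over a subset `T` of the unit sphere (the origin,
whose normalisation is `0 ∉ T`, is left out). -/
def unitCone (T : Set V) : Set V := {y | ‖y‖ < 1 ∧ ‖y‖⁻¹ • y ∈ T}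

variable [MeasurableSpace V] [BorelSpace V] [FiniteDimensional ℝ V]

omit [FiniteDimensional ℝ V] in
lemma measurableSet_unitCone {T : Set V} (hT : MeasurableSet T) :
    MeasurableSet (unitCone T) := by
  refine (measurableSet_lt measurable_norm measurable_const).inter ?_
  exact (measurable_norm.inv.smul measurable_id) hT

/-- The cone inequality up to a factor, for a piece `T` of the sphere at height at least `h` over
the hyperplane orthogonal to `z₀`. The slice at height `s < h` of the cone over `T` contains
`s • G`, where `G` is the central projection of `T` to the tangent hyperplane at `z₀`; and the
measure of `T` is at most that of `G`, since the way back is nonexpansive. Integrating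
`s ^ (d - 1)` over the heights `s < h` gives the bound. -/
lemma pow_mul_euclideanHausdorffMeasure_le_volume_unitCone_of_inner {T : Set V}
    (hT : MeasurableSet T) (hTs : T ⊆ Metric.sphere 0 1) {z₀ : V} (hz₀ : ‖z₀‖ = 1) {h : ℝ}
    (h0 : 0 < h) (hTh : ∀ z ∈ T, h ≤ inner ℝ z₀ z) :
    ENNReal.ofReal (h ^ Module.finrank ℝ V) * μHE[Module.finrank ℝ V - 1] T ≤
      Module.finrank ℝ V * volume (unitCone T) := by
  have hz0 : z₀ ≠ 0 := by rintro rfl; simp at hz₀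
  set d := Module.finrank ℝ V with hd
  have hdpos : 0 < d := by
    have : Nontrivial V := ⟨z₀, 0, hz0⟩
    exact Module.finrank_pos
  let G : Set V := (fun z => (inner ℝ z₀ z)⁻¹ • z) '' T
  have hTG : μHE[d - 1] T ≤ μHE[d - 1] G := by
    have hG : G ⊆ {y | 1 ≤ ‖y‖} := by
      rintro _ ⟨z, hz, rfl⟩
      have h1 : ‖z‖ = 1 := by simpa using hTs hz
      have h2 : 0 < inner ℝ z₀ z := h0.trans_le (hTh z hz)
      have h3 : inner ℝ z₀ z ≤ 1 := by simpa [hz₀, h1] using real_inner_le_norm z₀ z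
      rw [mem_ofPred_eq, norm_smul, h1, mul_one, norm_inv, Real.norm_of_nonneg h2.le]
      exact (one_le_inv₀ h2).2 h3
    have hsub : T ⊆ (fun y : V => ‖y‖⁻¹ • y) '' G := by
      intro z hz
      have h1 : ‖z‖ = 1 := by simpa using hTs hz
      have h2 : 0 < inner ℝ z₀ z := h0.trans_le (hTh z hz)
      refine ⟨_, ⟨z, hz, rfl⟩, ?_⟩
      simp only
      rw [norm_smul, h1, mul_one, norm_inv, Real.norm_of_nonneg h2.le, inv_inv, smul_smul,
        mul_inv_cancel₀ h2.ne', one_smul]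
    calc μHE[d - 1] T ≤ _ := measure_mono hsub
      _ ≤ _ := (lipschitzOnWith_inv_norm_smul.mono hG).euclideanHausdorffMeasure_image_le _
      _ = _ := by simp
  have hslice : ∀ s ∈ Ioo 0 h, ENNReal.ofReal (s ^ (d - 1)) * μHE[d - 1] G ≤
      μHE[d - 1] (unitCone T ∩ AffineSubspace.mk' (s • z₀ +ᵥ (0 : V)) (ℝ ∙ z₀)ᗮ) := by
    intro s hs
    have hsm := Measure.euclideanHausdorffMeasure_smul₀ (d - 1) hs.1.ne' G
    rw [ENNReal.smul_def, smul_eq_mul, ENNReal.coe_pow, ← enorm_eq_nnnorm,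
      Real.enorm_of_nonneg hs.1.le, ← ENNReal.ofReal_pow hs.1.le] at hsm
    rw [← hsm]
    refine measure_mono ?_
    rintro _ ⟨_, ⟨z, hz, rfl⟩, rfl⟩
    have h1 : ‖z‖ = 1 := by simpa using hTs hz
    have h2 : h ≤ inner ℝ z₀ z := hTh z hz
    have h3 : 0 < inner ℝ z₀ z := h0.trans_le h2
    have h4 : ‖(s * (inner ℝ z₀ z)⁻¹) • z‖ = s * (inner ℝ z₀ z)⁻¹ := by
      rw [norm_smul, h1, mul_one, Real.norm_of_nonneg (by have := hs.1; positivity)]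
    simp only [smul_smul]
    refine ⟨⟨?_, ?_⟩, ?_⟩
    · rw [h4, ← div_eq_mul_inv, div_lt_one h3]
      exact hs.2.trans_le h2
    · rw [h4, smul_smul, inv_mul_cancel₀ (by have := hs.1; positivity), one_smul]
      exact hz
    · rw [SetLike.mem_coe, AffineSubspace.mem_mk',
        Submodule.mem_orthogonal_singleton_iff_inner_right]
      simp only [vadd_eq_add, add_zero, vsub_eq_sub, inner_sub_right, real_inner_smul_right,
        real_inner_self_eq_norm_sq, hz₀]
      field_simp
      ring
  have hvol : volume (unitCone T) = ∫⁻ s : ℝ, μHE[d - 1]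
      (unitCone T ∩ AffineSubspace.mk' (s • z₀ +ᵥ (0 : V)) (ℝ ∙ z₀)ᗮ) := by
    rw [← InnerProductSpace.euclideanHausdorffMeasure_eq_volume,
      EuclideanGeometry.euclideanHausdorffMeasure_eq_lintegral (0 : V) hz0
        (measurableSet_unitCone hT), ← ofReal_norm, hz₀]
    simp [hd]
  have hint : ∫⁻ s in Ioo 0 h, ENNReal.ofReal (s ^ (d - 1)) = ENNReal.ofReal (h ^ d / d) := by
    rw [Measure.restrict_congr_set Ioo_ae_eq_Ioc, ← ofReal_integral_eq_lintegral_ofReal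
      (intervalIntegral.intervalIntegrable_pow (d - 1)).1, ← intervalIntegral.integral_of_le h0.le]
    · rw [integral_pow, Nat.sub_add_cancel hdpos, zero_pow hdpos.ne', sub_zero]
      congr 2
      have : ((d - 1 : ℕ) : ℝ) + 1 = d := by exact_mod_cast Nat.sub_add_cancel hdpos
      exact this
    · filter_upwards [ae_restrict_mem measurableSet_Ioc] with y hy
      exact pow_nonneg hy.1.le _
  have hfin : ENNReal.ofReal (h ^ d / d) * μHE[d - 1] G ≤ volume (unitCone T) := by
    rw [hvol, ← hint, ← lintegral_mul_const _ (by fun_prop)]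
    exact (setLIntegral_mono' measurableSet_Ioo hslice).trans (setLIntegral_le_lintegral _ _)
  calc ENNReal.ofReal (h ^ d) * μHE[d - 1] T
      ≤ ENNReal.ofReal (h ^ d) * μHE[d - 1] G := by gcongr
    _ = d * (ENNReal.ofReal (h ^ d / d) * μHE[d - 1] G) := by
      rw [← mul_assoc]
      congr 1
      rw [← ENNReal.ofReal_natCast, ← ENNReal.ofReal_mul (by positivity)]
      congr 1
      field_simp
    _ ≤ _ := by gcongr

/-- The area of a piece `T` of the unit sphere is at most `d` times the volume of the cone over it
(in fact they are equal). The sphere is cut into finitely many pieces, each of height at least `h`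
over some hyperplane, and `h` tends to `1`. -/
lemma euclideanHausdorffMeasure_le_volume_unitCone {T : Set V}
    (hT : MeasurableSet T) (hTs : T ⊆ Metric.sphere 0 1) :
    μHE[Module.finrank ℝ V - 1] T ≤ Module.finrank ℝ V * volume (unitCone T) := by
  set d := Module.finrank ℝ V with hd
  have key : ∀ h ∈ Ioo (0 : ℝ) 1, ENNReal.ofReal (h ^ d) * μHE[d - 1] T ≤
      d * volume (unitCone T) := by
    intro h hh
    let U : V → Set V := fun z₀ => {z | h < inner ℝ z₀ z}
    have hU : ∀ z₀, IsOpen (U z₀) := fun z₀ => isOpen_lt continuous_const (by fun_prop)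
    obtain ⟨t, htS, ht⟩ := (isCompact_sphere (0 : V) 1).elim_nhds_subcover U (fun z hz => by
      refine (hU z).mem_nhds ?_
      have hz1 : ‖z‖ = 1 := by simpa using hz
      simpa [U, real_inner_self_eq_norm_sq, hz1] using hh.2)
    have hind : ∀ t : Finset V, (∀ z ∈ t, z ∈ Metric.sphere (0 : V) 1) → ∀ S : Set V,
        MeasurableSet S → S ⊆ Metric.sphere 0 1 → S ⊆ ⋃ z ∈ t, U z →
        ENNReal.ofReal (h ^ d) * μHE[d - 1] S ≤ d * volume (unitCone S) := by
      classical
      intro t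
      induction t using Finset.induction_on with
      | empty =>
        intro _ S _ _ hS
        have : S = ∅ := by simpa using hS
        simp [this]
      | insert a t _ ih =>
        intro hz S hS hSs hSU
        have h1 := pow_mul_euclideanHausdorffMeasure_le_volume_unitCone_of_inner
          (hS.inter (hU a).measurableSet) (inter_subset_left.trans hSs)
          (z₀ := a) (by simpa using hz a (Finset.mem_insert_self a t)) hh.1 (fun z hz => hz.2.le)
        have h2 := ih (fun z hz' => hz z (Finset.mem_insert_of_mem hz')) (S \ U a)
          (hS.diff (hU a).measurableSet) (sdiff_subset.trans hSs) (fun z hz' => by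
            have := hSU hz'.1
            simp only [Finset.set_biUnion_insert, mem_union] at this
            exact this.resolve_left hz'.2)
        have h3 : volume (unitCone S) =
            volume (unitCone (S ∩ U a)) + volume (unitCone (S \ U a)) := by
          rw [← measure_inter_add_sdiff (unitCone S)
            (measurableSet_unitCone (hS.inter (hU a).measurableSet))]
          congr 2
          · ext y; simp only [unitCone, mem_inter_iff, mem_ofPred_eq]; tauto
          · ext y; simp only [unitCone, mem_inter_iff, mem_ofPred_eq, Set.mem_sdiff]; tauto
        calc ENNReal.ofReal (h ^ d) * μHE[d - 1] S
            ≤ ENNReal.ofReal (h ^ d) * (μHE[d - 1] (S ∩ U a) + μHE[d - 1] (S \ U a)) := by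
              gcongr; exact measure_le_inter_add_sdiff _ _ _
          _ ≤ _ := by
              rw [mul_add, h3, mul_add]
              exact add_le_add h1 h2
    exact hind t htS T hT hTs (hTs.trans ht)
  have hlim : Tendsto (fun h : ℝ => ENNReal.ofReal (h ^ d) * μHE[d - 1] T) (𝓝[<] 1)
      (𝓝 (1 * μHE[d - 1] T)) := by
    have h1 : Tendsto (fun h : ℝ => ENNReal.ofReal (h ^ d)) (𝓝[<] 1) (𝓝 1) := by
      have : ContinuousAt (fun h : ℝ => ENNReal.ofReal (h ^ d)) 1 :=
        (ENNReal.continuous_ofReal.comp (continuous_pow d)).continuousAt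
      simpa using this.tendsto.mono_left nhdsWithin_le_nhds
    exact ENNReal.Tendsto.mul_const h1 (Or.inl one_ne_zero)
  rw [one_mul] at hlim
  refine le_of_tendsto hlim ?_
  filter_upwards [Ioo_mem_nhdsLT (zero_lt_one (α := ℝ))] with h hh using key h hh

/-- The part of the sphere of radius `r` in the closed half-space `0 ≤ ℓ`. -/
def closedHalfSphere (ℓ : V →L[ℝ] ℝ) (r : ℝ) : Set V := {z | ‖z‖ = r ∧ 0 ≤ ℓ z}

/-- The part of the open ball of radius `r` in the closed half-space `0 ≤ ℓ`. -/
def halfBall (ℓ : V →L[ℝ] ℝ) (r : ℝ) : Set V := {z | ‖z‖ < r ∧ 0 ≤ ℓ z}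

lemma volume_setOf_apply_eq_zero {ℓ : V →L[ℝ] ℝ} (hℓ : ℓ ≠ 0) :
    volume {z : V | ℓ z = 0} = 0 := by
  refine Measure.addHaar_submodule volume ℓ.ker fun htop => hℓ ?_
  ext z
  have : z ∈ ℓ.ker := htop ▸ Submodule.mem_top
  exact this

lemma two_mul_volume_pos_halfBall {ℓ : V →L[ℝ] ℝ} (hℓ : ℓ ≠ 0) (r : ℝ) :
    2 * volume {z : V | ‖z‖ < r ∧ 0 < ℓ z} = volume (Metric.ball (0 : V) r) := by
  have hnull := volume_setOf_apply_eq_zero hℓ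
  have hneg : volume {z : V | ‖z‖ < r ∧ ℓ z < 0} = volume {z : V | ‖z‖ < r ∧ 0 < ℓ z} := by
    rw [← Measure.measure_neg]
    congr 1
    ext z
    simp
  have hm : MeasurableSet {z : V | 0 < ℓ z} := measurableSet_lt measurable_const (by fun_prop)
  have h1 := measure_inter_add_sdiff (μ := volume) (Metric.ball (0 : V) r) hm
  have h2 : volume (Metric.ball (0 : V) r \ {z : V | 0 < ℓ z}) =
      volume {z : V | ‖z‖ < r ∧ ℓ z < 0} := by
    refine le_antisymm ?_ (measure_mono ?_)
    · calc _ ≤ volume ({z : V | ‖z‖ < r ∧ ℓ z < 0} ∪ {z : V | ℓ z = 0}) := by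
            refine measure_mono fun z hz => ?_
            have hz2 : ℓ z ≤ 0 := not_lt.1 hz.2
            rcases hz2.lt_or_eq with h | h
            · exact Or.inl ⟨by simpa using hz.1, h⟩
            · exact Or.inr h
        _ ≤ _ := measure_union_le _ _
        _ = _ := by rw [hnull, add_zero]
    · exact fun z hz => ⟨by simpa using hz.1, not_lt.2 hz.2.le⟩
  rw [← h1, h2, hneg, two_mul]
  congr 2
  all_goals ext z; simp

lemma volume_halfBall_eq {ℓ : V →L[ℝ] ℝ} (hℓ : ℓ ≠ 0) (r : ℝ) :
    volume (halfBall ℓ r) = volume {z : V | ‖z‖ < r ∧ 0 < ℓ z} := by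
  have hnull := volume_setOf_apply_eq_zero hℓ
  refine le_antisymm ?_ (measure_mono fun z hz => ⟨hz.1, hz.2.le⟩)
  calc _ ≤ volume ({z : V | ‖z‖ < r ∧ 0 < ℓ z} ∪ {z : V | ℓ z = 0}) := by
        refine measure_mono fun z hz => ?_
        rcases hz.2.lt_or_eq with h | h
        · exact Or.inl ⟨hz.1, h⟩
        · exact Or.inr h.symm
    _ ≤ _ := measure_union_le _ _
    _ = _ := by rw [hnull, add_zero]

lemma volume_halfBall {ℓ ℓ' : V →L[ℝ] ℝ} (hℓ : ℓ ≠ 0) (hℓ' : ℓ' ≠ 0) {r : ℝ} (hr : 0 ≤ r) :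
    volume (halfBall ℓ r) =
      ENNReal.ofReal (r ^ Module.finrank ℝ V) * volume {z : V | ‖z‖ < 1 ∧ 0 < ℓ' z} := by
  have h2 : (2 : ℝ≥0∞) ≠ 0 := by simp
  have : Nontrivial V := by
    obtain ⟨z, hz⟩ := DFunLike.ne_iff.1 hℓ
    exact ⟨z, 0, fun h => hz (by simp [h])⟩
  rw [volume_halfBall_eq hℓ, ← ENNReal.mul_right_inj h2 (by simp),
    two_mul_volume_pos_halfBall hℓ, mul_left_comm, two_mul_volume_pos_halfBall hℓ',
    Measure.addHaar_ball _ _ hr]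

lemma euclideanHausdorffMeasure_closedHalfSphere_le {ℓ ℓ' : V →L[ℝ] ℝ} (hℓ : ℓ ≠ 0)
    (hℓ' : ℓ' ≠ 0) {r : ℝ} (hr : 0 < r) :
    μHE[Module.finrank ℝ V - 1] (closedHalfSphere ℓ r) ≤
      ENNReal.ofReal (r ^ (Module.finrank ℝ V - 1)) *
        (Module.finrank ℝ V * volume {z : V | ‖z‖ < 1 ∧ 0 < ℓ' z}) := by
  have hS : closedHalfSphere ℓ r = r • closedHalfSphere ℓ 1 := by
    ext z
    rw [Set.mem_smul_set_iff_inv_smul_mem₀ hr.ne']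
    simp only [closedHalfSphere, mem_ofPred_eq, norm_smul, norm_inv, Real.norm_of_nonneg hr.le,
      map_smul, smul_eq_mul]
    rw [inv_mul_eq_one₀ hr.ne', eq_comm, mul_nonneg_iff_of_pos_left (inv_pos.2 hr)]
  have hclosed : IsClosed (closedHalfSphere ℓ 1) :=
    (isClosed_eq continuous_norm continuous_const).inter
      (isClosed_le continuous_const ℓ.continuous)
  have h1 := euclideanHausdorffMeasure_le_volume_unitCone hclosed.measurableSet
    (fun z hz => by simpa using hz.1)
  have h2 : volume (unitCone (closedHalfSphere ℓ 1)) ≤ volume (halfBall ℓ 1) := by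
    refine measure_mono fun z hz => ⟨hz.1, ?_⟩
    have h3 : 0 ≤ ℓ (‖z‖⁻¹ • z) := hz.2.2
    have hz0 : z ≠ 0 := by
      rintro rfl
      simpa using hz.2.1
    rw [map_smul, smul_eq_mul] at h3
    exact (mul_nonneg_iff_of_pos_left (inv_pos.2 (norm_pos_iff.2 hz0))).1 h3
  rw [volume_halfBall hℓ hℓ' zero_le_one, one_pow, ENNReal.ofReal_one, one_mul] at h2
  have hsm := Measure.euclideanHausdorffMeasure_smul₀ (Module.finrank ℝ V - 1) hr.ne'
    (closedHalfSphere ℓ 1)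
  rw [ENNReal.smul_def, smul_eq_mul, ENNReal.coe_pow, ← enorm_eq_nnnorm,
    Real.enorm_of_nonneg hr.le, ← ENNReal.ofReal_pow hr.le] at hsm
  rw [hS, hsm]
  gcongr
  exact h1.trans (by gcongr)

lemma addHaar_ball_diff_ball [Nontrivial V] (μ : Measure V) [μ.IsAddHaarMeasure] (x : V)
    {a b : ℝ} (ha : 0 ≤ a) (hab : a ≤ b) :
    μ (Metric.ball x b \ Metric.ball x a) =
      ENNReal.ofReal (b ^ Module.finrank ℝ V - a ^ Module.finrank ℝ V) * μ (Metric.ball 0 1) := by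
  rw [measure_sdiff (Metric.ball_subset_ball hab) measurableSet_ball.nullMeasurableSet
    measure_ball_lt_top.ne, Measure.addHaar_ball _ _ (ha.trans hab), Measure.addHaar_ball _ _ ha,
    ← ENNReal.sub_mul (fun _ _ => measure_ball_lt_top.ne), ENNReal.ofReal_sub _ (by positivity)]

end Hausdorff

/-! ### Perimeter and reduced boundary in Euclidean space -/

section Perimeter

variable {n : ℕ}

lemma divergence_eq_zero_of_notMem_tsupport
    {X : EuclideanSpace ℝ (Fin n) → EuclideanSpace ℝ (Fin n)} {y : EuclideanSpace ℝ (Fin n)}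
    (hy : y ∉ tsupport X) : divergence X y = 0 := by
  have : fderiv ℝ X y = 0 := by
    have := support_fderiv_subset (𝕜 := ℝ) (f := X)
    by_contra h
    exact hy (this h)
  simp [divergence, this]

/-- Only the part of `F` in `U` matters for the fields supported in `U`. No measurability of `F` is
needed. -/
lemma setIntegral_divergence_inter {X : EuclideanSpace ℝ (Fin n) → EuclideanSpace ℝ (Fin n)}
    {U : Set (EuclideanSpace ℝ (Fin n))} (hU : IsOpen U) (hX : tsupport X ⊆ U)
    (F : Set (EuclideanSpace ℝ (Fin n))) :
    ∫ y in F, divergence X y = ∫ y in U ∩ F, divergence X y := by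
  rw [← Measure.restrict_restrict hU.measurableSet]
  exact (setIntegral_eq_integral_of_forall_compl_eq_zero
    fun y hy => divergence_eq_zero_of_notMem_tsupport fun h => hy (hX h)).symm

lemma fderiv_apply_apply {X : EuclideanSpace ℝ (Fin n) → EuclideanSpace ℝ (Fin n)}
    (hX : ContDiff ℝ 1 X) (y v : EuclideanSpace ℝ (Fin n)) (i : Fin n) :
    fderiv ℝ X y v i = fderiv ℝ (fun z => X z i) y v := by
  have h := ((EuclideanSpace.proj i : EuclideanSpace ℝ (Fin n) →L[ℝ] ℝ).hasFDerivAt.comp y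
    (hX.differentiable one_ne_zero y).hasFDerivAt)
  have h2 : fderiv ℝ (fun z => X z i) y = _ := h.fderiv
  rw [h2]
  rfl

lemma hasCompactSupport_apply {X : EuclideanSpace ℝ (Fin n) → EuclideanSpace ℝ (Fin n)}
    (hc : HasCompactSupport X) (i : Fin n) : HasCompactSupport (fun z => X z i) :=
  hc.comp_left (g := fun z : EuclideanSpace ℝ (Fin n) => z i) rfl

lemma contDiff_apply {X : EuclideanSpace ℝ (Fin n) → EuclideanSpace ℝ (Fin n)}
    (hX : ContDiff ℝ 1 X) (i : Fin n) : ContDiff ℝ 1 (fun z => X z i) :=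
  (EuclideanSpace.proj i : EuclideanSpace ℝ (Fin n) →L[ℝ] ℝ).contDiff.comp hX

lemma integrable_fderiv_apply {f : EuclideanSpace ℝ (Fin n) → ℝ} (hf : ContDiff ℝ 1 f)
    (hc : HasCompactSupport f) (v : EuclideanSpace ℝ (Fin n)) :
    Integrable (fun y => fderiv ℝ f y v) :=
  ((hf.continuous_fderiv one_ne_zero).clm_apply continuous_const).integrable_of_hasCompactSupport
    (hc.fderiv_apply (𝕜 := ℝ) v)

lemma setIntegral_divergence {X : EuclideanSpace ℝ (Fin n) → EuclideanSpace ℝ (Fin n)}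
    (hX : ContDiff ℝ 1 X) (hc : HasCompactSupport X) (F : Set (EuclideanSpace ℝ (Fin n))) :
    ∫ y in F, divergence X y =
      ∑ i, ∫ y in F, fderiv ℝ (fun z => X z i) y (EuclideanSpace.single i 1) := by
  simp only [divergence, fderiv_apply_apply hX]
  exact integral_finsetSum _ fun i _ =>
    (integrable_fderiv_apply (contDiff_apply hX i) (hasCompactSupport_apply hc i) _).integrableOn

lemma integral_divergence_eq_zero {X : EuclideanSpace ℝ (Fin n) → EuclideanSpace ℝ (Fin n)}
    (hX : ContDiff ℝ 1 X) (hc : HasCompactSupport X) : ∫ y, divergence X y = 0 := by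
  rw [← setIntegral_univ, setIntegral_divergence hX hc]
  refine Finset.sum_eq_zero fun i _ => ?_
  rw [setIntegral_univ]
  have hf := contDiff_apply hX i
  have hfc := hasCompactSupport_apply hc i
  have h := integral_mul_fderiv_eq_neg_fderiv_mul_of_integrable (μ := volume)
    (f := fun _ : EuclideanSpace ℝ (Fin n) => (1 : ℝ)) (g := fun z => X z i)
    (v := EuclideanSpace.single i 1) (by simp)
    (by simpa using integrable_fderiv_apply hf hfc _)
    (by simpa using hf.continuous.integrable_of_hasCompactSupport hfc)
    (fun _ _ => by fun_prop) (fun _ _ => hf.differentiable one_ne_zero _)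
  simpa using h

/-- If `F` has zero distributional gradient in a neighbourhood of `q`, then `q` is not in the reduced
boundary: there `ν` vanishes `μ`-almost everywhere, and `‖ν‖ = 1`, so that `μ` vanishes. -/
lemma notMem_euclideanReducedBoundary {F U : Set (EuclideanSpace ℝ (Fin n))}
    {q : EuclideanSpace ℝ (Fin n)} (hU : U ∈ 𝓝 q)
    (h : ∀ X : EuclideanSpace ℝ (Fin n) → EuclideanSpace ℝ (Fin n), ContDiff ℝ 1 X →
      HasCompactSupport X → tsupport X ⊆ U → ∫ y in F, divergence X y = 0) :
    q ∉ euclideanReducedBoundary F := by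
  rintro ⟨r₀, hr₀, μ, ν, hG, hpos, -⟩
  obtain ⟨r, hr, hrU⟩ := Metric.mem_nhds_iff.1 (inter_mem hU (Metric.ball_mem_nhds q hr₀))
  have := hG.finite
  have hν : Integrable ν μ :=
    (integrable_const (1 : ℝ)).mono' hG.measurable.aestronglyMeasurable
      (Eventually.of_forall fun y => (hG.norm_eq_one y).le)
  have hzero : ∀ᵐ y ∂μ, y ∈ Metric.ball q r → ν y = 0 := by
    refine Metric.isOpen_ball.ae_eq_zero_of_integral_contDiff_smul_eq_zero
      (hν.locallyIntegrable.locallyIntegrableOn _) fun g hg hgc hgs => ?_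
    refine ext_inner_left ℝ fun w => ?_
    obtain ⟨C, hC⟩ := hgc.exists_bound_of_continuous hg.continuous
    have hint : Integrable (fun y => g y • ν y) μ :=
      hν.bdd_smul C hg.continuous.aestronglyMeasurable (Eventually.of_forall hC)
    rw [inner_zero_right, ← integral_inner hint]
    let X : EuclideanSpace ℝ (Fin n) → EuclideanSpace ℝ (Fin n) := fun y => g y • w
    have hX : ContDiff ℝ 1 X := (hg.of_le (by norm_cast)).smul contDiff_const
    have hXc : HasCompactSupport X := hgc.smul_right
    have hXs : tsupport X ⊆ tsupport g := tsupport_smul_subset_left _ _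
    have h1 := hG.integral_eq X hX hXc (hXs.trans (hgs.trans (hrU.trans inter_subset_right)))
    rw [h X hX hXc (hXs.trans (hgs.trans (hrU.trans inter_subset_left)))] at h1
    rw [h1]
    congr 1
    ext y
    simp [X, real_inner_smul_left, real_inner_smul_right]
  have hnull : μ (Metric.ball q r) = 0 := by
    rw [← compl_compl (Metric.ball q r), ← mem_ae_iff]
    filter_upwards [hzero] with y hy hyb
    have := hG.norm_eq_one y
    rw [hy hyb, norm_zero] at this
    exact zero_ne_one this
  exact (hpos r hr).ne' hnull

lemma euclideanReducedBoundary_subset_frontier (F : Set (EuclideanSpace ℝ (Fin n))) :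
    euclideanReducedBoundary F ⊆ frontier F := by
  intro q hq
  refine ⟨?_, fun hint => ?_⟩
  · by_contra hcl
    refine notMem_euclideanReducedBoundary (isClosed_closure.isOpen_compl.mem_nhds hcl)
      (fun X hX hc hs => ?_) hq
    rw [setIntegral_divergence_inter isClosed_closure.isOpen_compl hs]
    have : (closure F)ᶜ ∩ F = ∅ := by
      ext y
      simpa using fun h hy => h (subset_closure hy)
    simp [this]
  · refine notMem_euclideanReducedBoundary (isOpen_interior.mem_nhds hint)
      (fun X hX hc hs => ?_) hq
    rw [setIntegral_divergence_inter isOpen_interior hs, inter_eq_left.2 interior_subset,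
      ← integral_divergence_eq_zero hX hc]
    exact setIntegral_eq_integral_of_forall_compl_eq_zero
      fun y hy => divergence_eq_zero_of_notMem_tsupport fun h => hy (hs h)

lemma relPerimeter_congr {F G U : Set (EuclideanSpace ℝ (Fin n))} (hU : IsOpen U)
    (h : U ∩ F = U ∩ G) : relPerimeter F U = relPerimeter G U := by
  unfold relPerimeter
  congr! 6 with X hX hc hs hb
  rw [setIntegral_divergence_inter hU hs, h, ← setIntegral_divergence_inter hU hs]

lemma relPerimeter_empty (U : Set (EuclideanSpace ℝ (Fin n))) : relPerimeter ∅ U = 0 := by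
  simp [relPerimeter]

/-- The derivative in direction `v` of the indicator of `F` is a measure of mass at most `C` when
`F` and its translates by `t • v` differ by a volume of at most `C * t`: the difference quotient
`∫_F (f (y + t • v) - f y) / t` is the integral of `f (y + t • v) / t` over `F` minus the one
over the translate. -/
lemma setIntegral_fderiv_le_of_symmDiff_le {F : Set (EuclideanSpace ℝ (Fin n))} (hF : MeasurableSet F)
    (hFfin : volume F ≠ ⊤) {v : EuclideanSpace ℝ (Fin n)} {C : ℝ}
    (hC : ∀ᶠ t : ℝ in 𝓝[>] 0, volume.real (symmDiff F ((fun y => y + t • v) ⁻¹' F)) ≤ C * t)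
    {f : EuclideanSpace ℝ (Fin n) → ℝ} (hf : ContDiff ℝ 1 f) (hc : HasCompactSupport f)
    (hb : ∀ y, |f y| ≤ 1) :
    ∫ y in F, fderiv ℝ f y v ≤ C := by
  obtain ⟨L, hL⟩ := hf.lipschitzWith_of_hasCompactSupport hc one_ne_zero
  have hg : Integrable (F.indicator (fun _ => (1 : ℝ)))
      (volume : Measure (EuclideanSpace ℝ (Fin n))) :=
    (integrable_indicator_iff hF).2 (integrableOn_const hFfin)
  have hlim := hL.integral_inv_smul_sub_mul_tendsto_integral_lineDeriv_mul (μ := volume) hg v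
  have hmul : ∀ u : EuclideanSpace ℝ (Fin n) → ℝ,
      ∫ y, u y * F.indicator (fun _ => (1 : ℝ)) y = ∫ y in F, u y := by
    intro u
    rw [← integral_indicator hF]
    congr 1
    ext y
    by_cases hy : y ∈ F <;> simp [hy]
  have hder : ∀ y, lineDeriv ℝ f y v = fderiv ℝ f y v := fun y =>
    (hf.differentiable one_ne_zero y).lineDeriv_eq_fderiv
  simp only [hmul, hder] at hlim
  refine le_of_tendsto hlim ?_
  filter_upwards [hC, self_mem_nhdsWithin] with t ht ht0
  have ht0 : 0 < t := ht0
  have hfi : Integrable f := hf.continuous.integrable_of_hasCompactSupport hc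
  have hgi : Integrable (fun y => f (y + t • v)) := hfi.comp_add_right (t • v)
  set F' : Set (EuclideanSpace ℝ (Fin n)) := (fun y => y + t • v) ⁻¹' F with hF'
  have hF'm : MeasurableSet F' := (measurable_id.add_const (t • v)) hF
  have hshift : ∫ y in F, f y = ∫ y in F', f (y + t • v) :=
    ((measurePreserving_add_right volume (t • v)).setIntegral_preimage_emb
      (measurableEmbedding_addRight _) f F).symm
  have hF'fin : volume F' ≠ ⊤ := by
    rwa [hF', (measurePreserving_add_right volume (t • v)).measure_preimage hF.nullMeasurableSet]
  have hsymm : volume (symmDiff F F') ≠ ⊤ :=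
    measure_ne_top_of_subset symmDiff_le_sup
      ((measure_union_lt_top hFfin.lt_top hF'fin.lt_top).ne)
  have key : ∫ y in F, (f (y + t • v) - f y) ≤ volume.real (symmDiff F F') := by
    rw [integral_sub hgi.integrableOn hfi.integrableOn, hshift, ← integral_indicator hF,
      ← integral_indicator hF'm, ← integral_sub (hgi.indicator hF) (hgi.indicator hF'm),
      ← integral_indicator_one (hF.symmDiff hF'm)]
    refine integral_mono ((hgi.indicator hF).sub (hgi.indicator hF'm))
      ((integrable_indicator_iff (hF.symmDiff hF'm)).2 (integrableOn_const hsymm)) fun y => ?_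
    have h1 := abs_le.1 (hb (y + t • v))
    by_cases hy : y ∈ F <;> by_cases hy' : y ∈ F' <;>
      simp [hy, hy', Set.mem_symmDiff] <;> linarith
  simp only [smul_eq_mul]
  rw [integral_const_mul, inv_mul_le_iff₀ ht0, mul_comm t C]
  exact key.trans ht

lemma relPerimeter_lt_top_of_symmDiff_le {F : Set (EuclideanSpace ℝ (Fin n))} (hF : MeasurableSet F)
    (hFfin : volume F ≠ ⊤) {C : EuclideanSpace ℝ (Fin n) → ℝ}
    (hC : ∀ v, ∀ᶠ t : ℝ in 𝓝[>] 0,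
      volume.real (symmDiff F ((fun y => y + t • v) ⁻¹' F)) ≤ C v * t)
    (U : Set (EuclideanSpace ℝ (Fin n))) : relPerimeter F U < ⊤ := by
  refine lt_of_le_of_lt (b := ENNReal.ofReal (∑ i, C (EuclideanSpace.single i 1))) ?_
    ENNReal.ofReal_lt_top
  unfold relPerimeter
  refine iSup_le fun X => iSup_le fun hX => iSup_le fun hc => iSup_le fun _ => iSup_le fun hb => ?_
  refine ENNReal.ofReal_le_ofReal ?_
  rw [setIntegral_divergence hX hc]
  refine Finset.sum_le_sum fun i _ => ?_
  refine setIntegral_fderiv_le_of_symmDiff_le hF hFfin (hC _) (contDiff_apply hX i)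
    (hasCompactSupport_apply hc i) fun y => ?_
  exact (PiLp.norm_apply_le (X y) i).trans (hb y)

lemma exists_volume_shell_eq [NeZero n]
    (A : EuclideanSpace ℝ (Fin n) ≃L[ℝ] EuclideanSpace ℝ (Fin n)) :
    ∃ κ : ℝ, 0 ≤ κ ∧ ∀ (a : EuclideanSpace ℝ (Fin n)) (s t : ℝ), 0 ≤ s → s ≤ t →
      volume {y | s ≤ ‖A y - a‖ ∧ ‖A y - a‖ < t} = ENNReal.ofReal ((t ^ n - s ^ n) * κ) := by
  have hκ := measure_ball_lt_top (μ := (volume : Measure (EuclideanSpace ℝ (Fin n))).map A)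
    (x := 0) (r := 1)
  refine ⟨_, ENNReal.toReal_nonneg (a := (volume : Measure (EuclideanSpace ℝ (Fin n))).map A
    (Metric.ball 0 1)), fun a s t hs hst => ?_⟩
  have h := addHaar_ball_diff_ball ((volume : Measure (EuclideanSpace ℝ (Fin n))).map A) a hs hst
  rw [Measure.map_apply A.continuous.measurable (measurableSet_ball.diff measurableSet_ball),
    finrank_euclideanSpace_fin] at h
  have hts : 0 ≤ t ^ n - s ^ n := sub_nonneg.2 (pow_le_pow_left₀ hs hst n)
  rw [ENNReal.ofReal_mul hts, ENNReal.ofReal_toReal hκ.ne, ← h]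
  congr 1
  ext y
  simp [dist_eq_norm, and_comm]

/-- Ellipsoids have finite perimeter: the symmetric difference of an ellipsoid and its translate by
`t • v` lies in an ellipsoidal shell of width `2 * t * ‖A v‖`. -/
lemma relPerimeter_ellipsoid_lt_top [NeZero n]
    (A : EuclideanSpace ℝ (Fin n) ≃L[ℝ] EuclideanSpace ℝ (Fin n)) (a : EuclideanSpace ℝ (Fin n))
    {r : ℝ} (hr : 0 < r) (U : Set (EuclideanSpace ℝ (Fin n))) :
    relPerimeter {y | ‖A y - a‖ < r} U < ⊤ := by
  obtain ⟨κ, hκ, hshell⟩ := exists_volume_shell_eq A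
  have hopen : IsOpen {y | ‖A y - a‖ < r} :=
    isOpen_lt (by fun_prop) continuous_const
  refine relPerimeter_lt_top_of_symmDiff_le (C := fun v => 2 * ‖A v‖ * n * (2 * r) ^ (n - 1) * κ)
    hopen.measurableSet ?_ (fun v => ?_) U
  · have := hshell a 0 r le_rfl hr.le
    simp only [norm_nonneg, true_and] at this
    rw [this]
    exact ENNReal.ofReal_ne_top
  · have hev : ∀ᶠ t : ℝ in 𝓝[>] 0, t * ‖A v‖ < r := by
      have : Tendsto (fun t : ℝ => t * ‖A v‖) (𝓝[>] 0) (𝓝 (0 * ‖A v‖)) :=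
        (tendsto_id.mono_left nhdsWithin_le_nhds).mul_const _
      rw [zero_mul] at this
      exact this.eventually_lt_const hr
    filter_upwards [hev, self_mem_nhdsWithin] with t ht ht0
    have ht0 : 0 < t := ht0
    have hs : 0 ≤ t * ‖A v‖ := by positivity
    have hnorm : ‖A (t • v)‖ = t * ‖A v‖ := by
      rw [map_smul, norm_smul, Real.norm_of_nonneg ht0.le]
    have hsub : symmDiff {y | ‖A y - a‖ < r} ((fun y => y + t • v) ⁻¹' {y | ‖A y - a‖ < r}) ⊆
        {y | r - t * ‖A v‖ ≤ ‖A y - a‖ ∧ ‖A y - a‖ < r + t * ‖A v‖} := by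
      intro y hy
      have h1 := norm_sub_norm_le (A y - a) (-A (t • v))
      have h2 := norm_add_le (A y - a) (A (t • v))
      rw [norm_neg, sub_neg_eq_add, hnorm] at h1
      rw [hnorm] at h2
      have h3 : A (y + t • v) - a = A y - a + A (t • v) := by rw [map_add]; abel
      simp only [Set.mem_symmDiff, mem_ofPred_eq, mem_preimage, h3, not_lt] at hy
      constructor <;> rcases hy with hy | hy <;> linarith [hy.1, hy.2]
    have hv := hshell a (r - t * ‖A v‖) (r + t * ‖A v‖) (by linarith) (by linarith)
    have hpow : (r + t * ‖A v‖) ^ n - (r - t * ‖A v‖) ^ n ≤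
        2 * (t * ‖A v‖) * n * (2 * r) ^ (n - 1) := by
      have h1 := abs_pow_sub_pow_le (r + t * ‖A v‖) (r - t * ‖A v‖) n
      have h2 : max |r + t * ‖A v‖| |r - t * ‖A v‖| ≤ 2 * r :=
        max_le (abs_le.2 ⟨by linarith, by linarith⟩) (abs_le.2 ⟨by linarith, by linarith⟩)
      have h3 : |r + t * ‖A v‖ - (r - t * ‖A v‖)| = 2 * (t * ‖A v‖) := by
        rw [abs_of_nonneg (by linarith)]; ring
      rw [h3] at h1
      refine (le_abs_self _).trans (h1.trans ?_)
      gcongr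
    rw [Measure.real]
    calc _ ≤ (ENNReal.ofReal (((r + t * ‖A v‖) ^ n - (r - t * ‖A v‖) ^ n) * κ)).toReal :=
          ENNReal.toReal_mono ENNReal.ofReal_ne_top ((measure_mono hsub).trans_eq hv)
      _ = ((r + t * ‖A v‖) ^ n - (r - t * ‖A v‖) ^ n) * κ := ENNReal.toReal_ofReal
          (mul_nonneg (sub_nonneg.2 (pow_le_pow_left₀ (by linarith) (by linarith) n)) hκ)
      _ ≤ 2 * (t * ‖A v‖) * n * (2 * r) ^ (n - 1) * κ := by gcongr
      _ = _ := by ring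

end Perimeter

/-! ### Bi-Lipschitz estimates for the charts of a Riemannian manifold -/

section Chart

open Manifold

variable {E : Type*} [NormedAddCommGroup E] [NormedSpace ℝ E] {H : Type*} [TopologicalSpace H]
  {I : ModelWithCorners ℝ E H}

lemma enorm_le_coe_mul_enorm {F G : Type*} [SeminormedAddGroup F] [SeminormedAddGroup G]
    {K : ℝ≥0} {a : F} {b : G} : ‖a‖ₑ ≤ K * ‖b‖ₑ ↔ ‖a‖ ≤ K * ‖b‖ := by
  rw [← ofReal_norm, ← ofReal_norm, ← ENNReal.ofReal_coe_nnreal, ← ENNReal.ofReal_mul K.coe_nonneg,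
    ENNReal.ofReal_le_ofReal_iff (by positivity)]

section

variable {M : Type*} [TopologicalSpace M] [ChartedSpace H M]
  [RiemannianBundle (fun p : M => TangentSpace I p)] [IsManifold I 1 M]

/-- The inner product of the tangent space at `x`, read in the chart at `x`, is the pullback of the
Euclidean one by a linear isomorphism `A`. -/
lemma exists_continuousLinearEquiv_norm_eq_symmL [FiniteDimensional ℝ E] {n : ℕ}
    (hn : Module.finrank ℝ E = n) (x : M) :
    ∃ A : E ≃L[ℝ] EuclideanSpace ℝ (Fin n),
      ∀ u, ‖A u‖ = ‖(trivializationAt E (TangentSpace I) x).symmL ℝ x u‖ := by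
  have hx : x ∈ (trivializationAt E (TangentSpace I) x).baseSet :=
    FiberBundle.mem_baseSet_trivializationAt' x
  let G := (trivializationAt E (TangentSpace I) x).continuousLinearEquivAt ℝ x hx
  have : FiniteDimensional ℝ (TangentSpace I x) := G.symm.toLinearEquiv.finiteDimensional
  let B := stdOrthonormalBasis ℝ (TangentSpace I x)
  have hd : Module.finrank ℝ (TangentSpace I x) = n := G.toLinearEquiv.finrank_eq.trans hn
  let B' := B.reindex (finCongr hd)
  refine ⟨G.symm.trans B'.repr.toContinuousLinearEquiv, fun u => ?_⟩
  have h : (trivializationAt E (TangentSpace I) x).symmL ℝ x u = G.symm u := by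
    exact (congrFun (Trivialization.symm_continuousLinearEquivAt_eq (R := ℝ)
      (trivializationAt E (TangentSpace I) x) hx) u).symm
  rw [h]
  exact B'.repr.norm_map (G.symm u)

variable [IsContinuousRiemannianBundle E (fun p : M => TangentSpace I p)]

/-- Near `x`, the derivative of the chart at `x` is almost nonexpansive for the norm of the tangent
space at `x`. -/
lemma eventually_enorm_symmL_mfderiv_extChartAt_le (x : M) {K : ℝ≥0} (hK : 1 < K) :
    ∀ᶠ y in 𝓝 x, ∀ v : TangentSpace I y,
      ‖(trivializationAt E (TangentSpace I) x).symmL ℝ x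
        (mfderiv I 𝓘(ℝ, E) (extChartAt I x) y v)‖ₑ ≤ K * ‖v‖ₑ := by
  filter_upwards [eventually_norm_symmL_trivializationAt_self_comp_lt E
    (fun p : M => TangentSpace I p) x (r := K) (by exact_mod_cast hK),
    chart_source_mem_nhds H x] with y hy h'y v
  rw [← TangentBundle.continuousLinearMapAt_trivializationAt h'y]
  exact enorm_le_coe_mul_enorm.2 (ContinuousLinearMap.le_of_opNorm_le _ hy.le v)

/-- Near `x`, the derivative of the inverse of the chart at `x` is almost nonexpansive for the norm
of the tangent space at `x`. -/
lemma eventually_enorm_mfderivWithin_symm_extChartAt_le (x : M) {K : ℝ≥0} (hK : 1 < K) :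
    ∀ᶠ y in 𝓝[range I] (extChartAt I x x), ∀ u : E,
      ‖mfderivWithin 𝓘(ℝ, E) I (extChartAt I x).symm (range I) y u‖ₑ
        ≤ K * ‖(trivializationAt E (TangentSpace I) x).symmL ℝ x u‖ₑ := by
  have h1 := (eventually_norm_symmL_trivializationAt_comp_self_lt E
    (fun p : M => TangentSpace I p) x (r := K) (by exact_mod_cast hK)).and
    (chart_source_mem_nhds H x)
  have hc : Tendsto (extChartAt I x).symm (𝓝[range I] (extChartAt I x x)) (𝓝 x) := by
    have := (continuousAt_extChartAt_symm (I := I) x).tendsto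
    rw [extChartAt_to_inv (I := I) x] at this
    exact this.mono_left nhdsWithin_le_nhds
  filter_upwards [hc.eventually h1, extChartAt_target_mem_nhdsWithin x] with y ⟨hy, h'y⟩ hyt u
  have hx : x ∈ (trivializationAt E (TangentSpace I) x).baseSet :=
    FiberBundle.mem_baseSet_trivializationAt' x
  have h3 := ContinuousLinearMap.le_of_opNorm_le _ hy.le
    ((trivializationAt E (TangentSpace I) x).symmL ℝ x u)
  have h5 := Trivialization.continuousLinearMapAt_symmL (R := ℝ)
    (trivializationAt E (TangentSpace I) x) hx u
  rw [ContinuousLinearMap.comp_apply, h5] at h3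
  rw [TangentBundle.symmL_trivializationAt h'y] at h3
  have h4 := enorm_le_coe_mul_enorm.2 h3
  rw [(extChartAt I x).right_inv hyt] at h4
  exact h4
end

variable {M : Type*} [EMetricSpace M] [ChartedSpace H M]
  [RiemannianBundle (fun p : M => TangentSpace I p)] [IsManifold I 1 M]
  [IsContinuousRiemannianBundle E (fun p : M => TangentSpace I p)]
  [IsRiemannianManifold I M] {F : Type*} [NormedAddCommGroup F] [NormedSpace ℝ F]

/-- Near `x`, the chart at `x` followed by `A` is `K`-Lipschitz. A path from `p` to `q` that is almost
as short as possible stays near `x`, since each of its points is at a distance from `p` of at most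
its length; so its image in the chart is longer by a factor of at most `K`, and it is at least as
long as the segment. -/
lemma exists_nhds_edist_extChartAt_le [CompleteSpace F] (x : M) (A : E →L[ℝ] F)
    (hA : ∀ u, ‖A u‖ = ‖(trivializationAt E (TangentSpace I) x).symmL ℝ x u‖)
    {K : ℝ≥0} (hK : 1 < K) :
    ∃ W ∈ 𝓝 x, ∀ p ∈ W, ∀ q ∈ W,
      edist (A (extChartAt I x p)) (A (extChartAt I x q)) ≤ K * edist p q := by
  obtain ⟨ε, hε, hU⟩ := EMetric.mem_nhds_iff.1 (Filter.inter_mem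
    (eventually_enorm_symmL_mfderiv_extChartAt_le (I := I) x hK) (chart_source_mem_nhds H x))
  have hε3 : 0 < ε / 3 := ENNReal.div_pos hε.ne' (by simp)
  have hsum : ε / 3 + (ε / 3 + ε / 3) = ε := by rw [← add_assoc]; exact ENNReal.add_thirds ε
  refine ⟨Metric.eball x (ε / 3), Metric.eball_mem_nhds x hε3, fun p hp q hq => ?_⟩
  have hpq : edist p q < ε / 3 + ε / 3 := (edist_triangle p x q).trans_lt
    (ENNReal.add_lt_add hp (by rw [edist_comm]; exact hq))
  have hK0 : (K : ℝ≥0∞) ≠ 0 := by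
    have : (0 : ℝ≥0) < K := zero_lt_one.trans hK
    exact_mod_cast this.ne'
  rw [← ENNReal.div_le_iff' hK0 ENNReal.coe_ne_top]
  refine le_of_forall_gt_imp_ge_of_dense fun R hR => ?_
  rw [ENNReal.div_le_iff' hK0 ENNReal.coe_ne_top]
  have hlt : riemannianEDist I p q < min R (ε / 3 + ε / 3) := by
    rw [← IsRiemannianManifold.out (I := I) p q]; exact lt_min hR hpq
  obtain ⟨γ, hγ0, hγ1, hγ, hlen, -, -⟩ :=
    exists_lt_locally_constant_of_riemannianEDist_lt hlt zero_lt_one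
  have hmem : ∀ t ∈ Icc (0 : ℝ) 1, γ t ∈ Metric.eball x ε := by
    intro t ht
    have h1 : edist p (γ t) < ε / 3 + ε / 3 := by
      rw [IsRiemannianManifold.out (I := I) p (γ t)]
      calc riemannianEDist I p (γ t) ≤ pathELength I γ 0 t :=
            riemannianEDist_le_pathELength hγ.contMDiffOn hγ0 rfl ht.1
        _ ≤ pathELength I γ 0 1 := pathELength_mono le_rfl ht.2
        _ < _ := hlen.trans_le (min_le_right _ _)
    rw [Metric.mem_eball, edist_comm]
    calc edist x (γ t) ≤ edist x p + edist p (γ t) := edist_triangle _ _ _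
      _ < ε / 3 + (ε / 3 + ε / 3) := ENNReal.add_lt_add (by rw [edist_comm]; exact hp) h1
      _ = ε := hsum
  let f : ℝ → E := extChartAt I x ∘ γ
  have hfm : ContMDiffOn 𝓘(ℝ, ℝ) 𝓘(ℝ, E) 1 f (Icc 0 1) :=
    contMDiffOn_extChartAt.comp (I' := I) (t := (chartAt H x).source)
      hγ.contMDiffOn (fun t ht => (hU (hmem t ht)).2)
  have hf : ContDiffOn ℝ 1 f (Icc 0 1) := contMDiffOn_iff_contDiffOn.1 hfm
  have hAf : ContDiffOn ℝ 1 (A ∘ f) (Icc 0 1) := A.contDiff.comp_contDiffOn hf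
  calc edist (A (extChartAt I x p)) (A (extChartAt I x q))
      = ‖(A ∘ f) 1 - (A ∘ f) 0‖ₑ := by
        rw [edist_comm, edist_eq_enorm_sub]; simp [f, hγ0, hγ1]
    _ ≤ ∫⁻ t in Icc 0 1, ‖derivWithin (A ∘ f) (Icc 0 1) t‖ₑ :=
        enorm_sub_le_lintegral_derivWithin_Icc_of_contDiffOn_Icc hAf zero_le_one
    _ ≤ ∫⁻ t in Icc 0 1, K * ‖mfderivWithin 𝓘(ℝ, ℝ) I γ (Icc 0 1) t 1‖ₑ := by
        refine setLIntegral_mono' measurableSet_Icc fun t ht => ?_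
        have hu := uniqueDiffOn_Icc (zero_lt_one (α := ℝ)) t ht
        have h1 : derivWithin (A ∘ f) (Icc 0 1) t = A (fderivWithin ℝ f (Icc 0 1) t 1) := by
          rw [← fderivWithin_derivWithin, fderivWithin_comp t
            A.differentiableAt.differentiableWithinAt (hf.differentiableOn one_ne_zero t ht)
            (mapsTo_univ _ _) hu, fderivWithin_univ, A.fderiv]
          rfl
        have h2 : mfderivWithin 𝓘(ℝ, ℝ) 𝓘(ℝ, E) f (Icc 0 1) t =
            (mfderiv I 𝓘(ℝ, E) (extChartAt I x) (γ t)) ∘L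
              (mfderivWithin 𝓘(ℝ, ℝ) I γ (Icc 0 1) t) := by
          apply mfderiv_comp_mfderivWithin
          · exact mdifferentiableAt_extChartAt (hU (hmem t ht)).2
          · exact (hγ.mdifferentiable one_ne_zero).mdifferentiableOn _ ht
          · rw [uniqueMDiffWithinAt_iff_uniqueDiffWithinAt]; exact hu
        have h3 : fderivWithin ℝ f (Icc 0 1) t 1 = (mfderiv I 𝓘(ℝ, E) (extChartAt I x) (γ t))
              (mfderivWithin 𝓘(ℝ, ℝ) I γ (Icc 0 1) t 1) := by
          rw [← mfderivWithin_eq_fderivWithin]; exact congr($h2 1)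
        have h4 := (hU (hmem t ht)).1 (mfderivWithin 𝓘(ℝ, ℝ) I γ (Icc 0 1) t 1)
        refine le_trans (le_of_eq ?_) h4
        rw [h1, h3, ← ofReal_norm, ← ofReal_norm]
        exact congrArg _ (hA _)
    _ = K * pathELength I γ 0 1 := by
      rw [lintegral_const_mul' _ _ ENNReal.coe_ne_top,
          pathELength_eq_lintegral_mfderivWithin_Icc]
    _ ≤ K * R := by
      gcongr; exact hlen.le.trans (min_le_left _ _)

/-- Near `x`, the inverse of the chart at `x` is `K`-Lipschitz for the norm `‖A ·‖`: the range of the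
chart is convex, and the image in `M` of the segment from `y` to `y'` is a path of length at most
`K * ‖A (y' - y)‖`. -/
lemma exists_ball_edist_extChartAt_symm_le (x : M) (A : E →L[ℝ] F)
    (hA : ∀ u, ‖A u‖ = ‖(trivializationAt E (TangentSpace I) x).symmL ℝ x u‖)
    {K : ℝ≥0} (hK : 1 < K) :
    ∃ ρ > 0, Metric.ball (extChartAt I x x) ρ ∩ range I ⊆ (extChartAt I x).target ∧
      ∀ y ∈ Metric.ball (extChartAt I x x) ρ ∩ range I,
      ∀ y' ∈ Metric.ball (extChartAt I x x) ρ ∩ range I,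
      edist ((extChartAt I x).symm y) ((extChartAt I x).symm y') ≤ K * edist (A y) (A y') := by
  obtain ⟨r, r_pos, hr⟩ := Metric.mem_nhdsWithin_iff.1 (inter_mem
    (extChartAt_target_mem_nhdsWithin (I := I) x)
    (eventually_enorm_mfderivWithin_symm_extChartAt_le (I := I) x hK))
  refine ⟨r, r_pos, fun y hy => (hr hy).1, fun y hy y' hy' => ?_⟩
  let η := ContinuousAffineMap.lineMap (R := ℝ) y y'
  set γ := (extChartAt I x).symm ∘ η
  have hη : ∀ t ∈ Icc (0 : ℝ) 1, η t ∈ Metric.ball (extChartAt I x x) r ∩ range I := by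
    have himg : η '' Icc 0 1 ⊆ Metric.ball (extChartAt I x x) r ∩ range I := by
      simp only [ContinuousAffineMap.coe_lineMap_eq, ← segment_eq_image_lineMap, η]
      exact ((convex_ball _ _).inter I.convex_range).segment_subset hy hy'
    exact fun t ht => himg (mem_image_of_mem _ ht)
  have η_smooth : ContMDiffOn 𝓘(ℝ, ℝ) 𝓘(ℝ, E) 1 η (Icc 0 1) := by
    apply ContMDiff.contMDiffOn
    rw [contMDiff_iff_contDiff]
    exact ContinuousAffineMap.contDiff _
  rw [IsRiemannianManifold.out (I := I)]
  have : riemannianEDist I ((extChartAt I x).symm y) ((extChartAt I x).symm y') ≤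
      pathELength I γ 0 1 := by
    apply riemannianEDist_le_pathELength _ _ _ zero_le_one
    · exact (contMDiffOn_extChartAt_symm x).comp η_smooth (fun t ht => (hr (hη t ht)).1)
    · simp [γ, η, ContinuousAffineMap.coe_lineMap_eq]
    · simp [γ, η, ContinuousAffineMap.coe_lineMap_eq]
  apply this.trans
  have hconst : K * edist (A y) (A y') = ∫⁻ t in Icc (0 : ℝ) 1, K * edist (A y) (A y') := by
    simp
  rw [hconst, pathELength_eq_lintegral_mfderivWithin_Icc]
  refine setLIntegral_mono' measurableSet_Icc fun t ht => ?_
  have hu := uniqueDiffOn_Icc (zero_lt_one (α := ℝ)) t ht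
  have h2 : mfderivWithin 𝓘(ℝ, ℝ) I γ (Icc 0 1) t =
      (mfderivWithin 𝓘(ℝ, E) I (extChartAt I x).symm (range I) (η t)) ∘L
        (mfderivWithin 𝓘(ℝ, ℝ) 𝓘(ℝ, E) η (Icc 0 1) t) := by
    apply mfderivWithin_comp
    · exact mdifferentiableWithinAt_extChartAt_symm (hr (hη t ht)).1
    · exact η_smooth.mdifferentiableOn one_ne_zero t ht
    · exact fun s hs => (hη s hs).2
    · rw [uniqueMDiffWithinAt_iff_uniqueDiffWithinAt]; exact hu
  have h3 : fderivWithin ℝ η (Icc 0 1) t 1 = y' - y := by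
    rw [fderivWithin_eq_fderiv hu (ContinuousAffineMap.differentiableAt _)]
    simp [η]
  have h4 : mfderivWithin 𝓘(ℝ, ℝ) I γ (Icc 0 1) t 1 =
      mfderivWithin 𝓘(ℝ, E) I (extChartAt I x).symm (range I) (η t) (y' - y) := by
    rw [← h3, ← mfderivWithin_eq_fderivWithin]; exact congr($h2 1)
  rw [h4]
  refine ((hr (hη t ht)).2 (y' - y)).trans (le_of_eq ?_)
  rw [edist_comm, edist_eq_enorm_sub, ← map_sub, ← ofReal_norm, ← ofReal_norm, hA]

end Chart

/-! ### Perimeter and reduced boundary in a manifold -/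

section ReducedBoundary

/-- Every chart of the maximal atlas takes interior points of `M` to interior points of its target:
the differential of a change of charts is onto, so it cannot take an interior point to a boundary
point of the convex range of the model. -/
lemma mem_interior_extend_target_of_isInteriorPoint {E H M : Type*} [NormedAddCommGroup E]
    [NormedSpace ℝ E] [TopologicalSpace H] {I : ModelWithCorners ℝ E H} [TopologicalSpace M]
    [ChartedSpace H M] {k : WithTop ℕ∞} [IsManifold I k M] (hk : k ≠ 0) {p : M}
    (hp : I.IsInteriorPoint p) {e : OpenPartialHomeomorph M H}
    (he : e ∈ IsManifold.maximalAtlas I k M) (hpe : p ∈ e.source) :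
    e.extend I p ∈ interior (e.extend I).target := by
  have hp' := I.isInteriorPoint_iff.1 hp
  have hpc := mem_chart_source H p
  have hc := IsManifold.chart_mem_maximalAtlas (I := I) (n := k) p
  let φ := I.extendCoordChange (chartAt H p) e
  have hφ : ContDiffOn ℝ k φ φ.source := I.contDiffOn_extendCoordChange hc he
  have hsurj : Function.Surjective (fderivWithin ℝ φ φ.source (extChartAt I p p)) :=
    (I.isInvertible_fderivWithin_extendCoordChange hk hc he <| by simp [hpe]).surjective
  have hφx : φ.source ∈ 𝓝 (extChartAt I p p) := by
    simp_rw [φ, ModelWithCorners.extendCoordChange, PartialEquiv.trans_source,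
      PartialEquiv.symm_source, Filter.inter_mem_iff]
    refine ⟨mem_interior_iff_mem_nhds.1 hp', ?_⟩
    rw [e.extend_source]
    exact (chartAt H p).extend_preimage_mem_nhds hpc (e.open_source.mem_nhds hpe)
  rw [fderivWithin_of_mem_nhds hφx] at hsurj
  refine e.mem_interior_extend_target (e.map_source hpe) ?_
  have hval : φ (extChartAt I p p) = e.extend I p := by simp [φ]
  have hmem := ((hφ.differentiableOn hk).differentiableAt
    hφx).mem_interior_convex_of_surjective_fderiv hφx I.convex_range I.isClosed_range
    I.nonempty_interior (φ.mapsTo.mono_right <| by simp [φ, inter_assoc]) hsurj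
  rw [hval] at hmem
  exact hmem

variable {n : ℕ} [NeZero n] {M : Type*} [TopologicalSpace M]
  [ChartedSpace (EuclideanHalfSpace n) M]

lemma reducedBoundary_subset_frontier [IsManifold (𝓡∂ n) ∞ M] (E : Set M) :
    reducedBoundary (n := n) E ⊆ frontier E := by
  rintro p ⟨hp, e, he, hpe, hq⟩
  have hint := mem_interior_extend_target_of_isInteriorPoint (by simp) hp he hpe
  have hcont : ContinuousAt (e.extend (𝓡∂ n)).symm (e.extend (𝓡∂ n) p) :=
    e.continuousAt_extend_symm hpe
  have hleft := e.extend_left_inv (I := 𝓡∂ n) hpe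
  have hfr := euclideanReducedBoundary_subset_frontier _ hq
  rw [frontier_eq_closure_inter_closure, mem_inter_iff, mem_closure_iff_frequently,
    mem_closure_iff_frequently] at hfr ⊢
  have htgt : (e.extend (𝓡∂ n)).target ∈ 𝓝 (e.extend (𝓡∂ n) p) := mem_interior_iff_mem_nhds.1 hint
  have hcont' : Tendsto (e.extend (𝓡∂ n)).symm (𝓝 (e.extend (𝓡∂ n) p)) (𝓝 p) := by
    have := hcont.tendsto
    rwa [hleft] at this
  refine ⟨hcont'.frequently (hfr.1.mono fun y hy => hy.2), hcont'.frequently ?_⟩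
  exact (hfr.2.and_eventually htgt).mono fun y hy h => hy.1 ⟨hy.2, h⟩

/-- A set whose closure lies in the domain of the chart at `x`, and which is cut out by an ellipsoid
there, has finite perimeter. -/
lemma hasFinitePerimeter_of_ellipsoid [IsManifold (𝓡∂ n) ∞ M] (x : M)
    (A : EuclideanSpace ℝ (Fin n) ≃L[ℝ] EuclideanSpace ℝ (Fin n)) (a : EuclideanSpace ℝ (Fin n))
    {r : ℝ} (hr : 0 < r) {E : Set M} (hE : closure E ⊆ (extChartAt (𝓡∂ n) x).source)
    (hE' : ∀ p ∈ (extChartAt (𝓡∂ n) x).source, p ∈ E ↔ ‖A (extChartAt (𝓡∂ n) x p) - a‖ < r) :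
    HasFinitePerimeter (n := n) E := by
  intro p
  by_cases hp : p ∈ closure E
  · refine ⟨chartAt _ x, IsManifold.chart_mem_maximalAtlas x, by simpa using hE hp, 1,
      one_pos, ?_⟩
    rw [relPerimeter_congr (G := {y | ‖A y - a‖ < r}) (isOpen_interior.inter Metric.isOpen_ball)]
    · exact relPerimeter_ellipsoid_lt_top A a hr _
    · ext y
      refine and_congr_right fun hy => ?_
      have hyt : y ∈ (extChartAt (𝓡∂ n) x).target := interior_subset hy.1
      have h1 := hE' _ ((extChartAt (𝓡∂ n) x).map_target hyt)
      rw [(extChartAt (𝓡∂ n) x).right_inv hyt] at h1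
      exact ⟨fun h => h1.1 h.2, fun h => ⟨hyt, h1.2 h⟩⟩
  · have hnhds : (extChartAt (𝓡∂ n) p).symm ⁻¹' Eᶜ ∈ 𝓝 (extChartAt (𝓡∂ n) p p) := by
      refine (continuousAt_extChartAt_symm p).preimage_mem_nhds ?_
      rw [extChartAt_to_inv]
      exact mem_of_superset (isClosed_closure.isOpen_compl.mem_nhds hp)
        (compl_subset_compl.2 subset_closure)
    obtain ⟨ρ, hρ, hball⟩ := Metric.mem_nhds_iff.1 hnhds
    refine ⟨chartAt _ p, IsManifold.chart_mem_maximalAtlas p, mem_chart_source _ p, ρ, hρ, ?_⟩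
    rw [relPerimeter_congr (G := ∅) (isOpen_interior.inter Metric.isOpen_ball),
      relPerimeter_empty]
    · exact ENNReal.zero_lt_top
    · rw [inter_empty, eq_empty_iff_forall_notMem]
      rintro y ⟨⟨_, hy⟩, hy'⟩
      exact hball hy hy'.2

end ReducedBoundary

/-! ### Half-balls around a boundary point -/

section HalfBall

variable {n : ℕ} [NeZero n] {M : Type*} [MetricSpace M]
  [ChartedSpace (EuclideanHalfSpace n) M] [IsManifold (𝓡∂ n) ∞ M]
  [RiemannianBundle (fun p : M => TangentSpace (𝓡∂ n) p)]
  [IsContMDiffRiemannianBundle (𝓡∂ n) ∞ (EuclideanSpace ℝ (Fin n))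
    (fun p : M => TangentSpace (𝓡∂ n) p)]
  [IsRiemannianManifold (𝓡∂ n) M]

/-- The half-balls `Ψ '' halfBall ℓ r` of `M` around a boundary point `x`. Here `Ψ` is the inverse of
the chart at `x` in linear coordinates that are orthonormal at `x`, `Θ` is the inverse of `Ψ`, and
`ℓ` defines the image of `∂M` in these coordinates. The linear functional `ℓ` does not depend on
`K` and on the neighbourhood `N` of `x`, only the radius `r₀` does. -/
lemma exists_halfBall_parametrization {x : M} (hx : x ∈ (𝓡∂ n).boundary M) :
    ∃ ℓ : EuclideanSpace ℝ (Fin n) →L[ℝ] ℝ, ℓ ≠ 0 ∧ ∀ K : ℝ≥0, 1 < K → ∀ N ∈ 𝓝 x,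
      ∃ r₀ > 0, ∃ (Ψ : EuclideanSpace ℝ (Fin n) → M) (Θ : M → EuclideanSpace ℝ (Fin n)),
        LipschitzOnWith K Ψ {z | ‖z‖ ≤ r₀ ∧ 0 ≤ ℓ z} ∧
        LipschitzOnWith K Θ (Ψ '' {z | ‖z‖ ≤ r₀ ∧ 0 ≤ ℓ z}) ∧
        (∀ z, ‖z‖ ≤ r₀ → 0 ≤ ℓ z → Θ (Ψ z) = z ∧ Ψ z ∈ N) ∧
        ∀ r, 0 < r → r ≤ r₀ → IsOpen (Ψ '' halfBall ℓ r) ∧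
          HasFinitePerimeter (n := n) (Ψ '' halfBall ℓ r) ∧
          reducedBoundary (n := n) (Ψ '' halfBall ℓ r) ⊆ Ψ '' closedHalfSphere ℓ r := by
  have : IsContinuousRiemannianBundle (EuclideanSpace ℝ (Fin n))
      (fun p : M => TangentSpace (𝓡∂ n) p) := by
    obtain ⟨g, hg, hg'⟩ := IsContMDiffRiemannianBundle.exists_contMDiff (IB := 𝓡∂ n) (n := ∞)
      (F := EuclideanSpace ℝ (Fin n)) (E := fun p : M => TangentSpace (𝓡∂ n) p)
    exact ⟨g, hg.continuous, hg'⟩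
  set φ := extChartAt (𝓡∂ n) x with hφ
  set c := φ x with hc
  obtain ⟨A, hA⟩ := exists_continuousLinearEquiv_norm_eq_symmL (I := 𝓡∂ n)
    (finrank_euclideanSpace_fin (𝕜 := ℝ) (n := n)) x
  -- the chart takes the boundary point `x` to the hyperplane that bounds the half-space
  have hc0 : c 0 = 0 := by
    have h1 : c ∈ frontier (range (𝓡∂ n)) := hx
    rw [frontier_range_modelWithCornersEuclideanHalfSpace] at h1
    exact h1.symm
  let ℓ : EuclideanSpace ℝ (Fin n) →L[ℝ] ℝ :=
    (EuclideanSpace.proj 0 : EuclideanSpace ℝ (Fin n) →L[ℝ] ℝ).comp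
      (A.symm : EuclideanSpace ℝ (Fin n) →L[ℝ] EuclideanSpace ℝ (Fin n))
  have hℓ : ∀ z, ℓ z = (A.symm z) 0 := fun z => rfl
  refine ⟨ℓ, ?_, fun K hK N hN => ?_⟩
  · intro h0
    have h1 := hℓ (A (EuclideanSpace.single 0 1))
    rw [h0] at h1
    simp at h1
  obtain ⟨W, hW, hlow⟩ := exists_nhds_edist_extChartAt_le (I := 𝓡∂ n) x
    (A : EuclideanSpace ℝ (Fin n) →L[ℝ] EuclideanSpace ℝ (Fin n)) hA hK
  obtain ⟨ρ, hρ, hρt, hup⟩ := exists_ball_edist_extChartAt_symm_le (I := 𝓡∂ n) x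
    (A : EuclideanSpace ℝ (Fin n) →L[ℝ] EuclideanSpace ℝ (Fin n)) hA hK
  have hpre : φ.symm ⁻¹' (W ∩ N) ∈ 𝓝 c := by
    refine (continuousAt_extChartAt_symm x).preimage_mem_nhds ?_
    rw [extChartAt_to_inv]
    exact inter_mem hW hN
  obtain ⟨δ, hδ, hδW⟩ := Metric.mem_nhds_iff.1 hpre
  set S := ‖(A.symm : EuclideanSpace ℝ (Fin n) →L[ℝ] EuclideanSpace ℝ (Fin n))‖ with hS
  have hS0 : 0 ≤ S := norm_nonneg _
  -- for `‖z‖ ≤ r₀` the point `A.symm z` has norm less than `ρ` and `δ`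
  set r₀ := min ρ δ / (S + 1) with hr₀
  have hr₀pos : 0 < r₀ := div_pos (lt_min hρ hδ) (by linarith)
  let D : Set (EuclideanSpace ℝ (Fin n)) := {z | ‖z‖ ≤ r₀ ∧ 0 ≤ ℓ z}
  have hD : ∀ z ∈ D, c + A.symm z ∈ Metric.ball c ρ ∩ range (𝓡∂ n) ∧
      c + A.symm z ∈ Metric.ball c δ := by
    intro z hz
    have h1 : ‖A.symm z‖ < min ρ δ := by
      have h2 : ‖A.symm z‖ ≤ S * ‖z‖ :=
        (A.symm : EuclideanSpace ℝ (Fin n) →L[ℝ] EuclideanSpace ℝ (Fin n)).le_opNorm z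
      have h3 : S * ‖z‖ ≤ S * r₀ := mul_le_mul_of_nonneg_left hz.1 hS0
      have h4 : (S + 1) * r₀ = min ρ δ := by rw [hr₀]; field_simp
      linarith
    refine ⟨⟨?_, ?_⟩, ?_⟩
    · simpa using h1.trans_le (min_le_left _ _)
    · rw [range_modelWithCornersEuclideanHalfSpace, mem_ofPred_eq, PiLp.add_apply, hc0, zero_add]
      exact hz.2
    · simpa using h1.trans_le (min_le_right _ _)
  let Ψ : EuclideanSpace ℝ (Fin n) → M := fun z => φ.symm (c + A.symm z)
  let Θ : M → EuclideanSpace ℝ (Fin n) := fun p => A (φ p - c)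
  have hφΨ : ∀ z ∈ D, φ (Ψ z) = c + A.symm z := fun z hz =>
    φ.right_inv (hρt (hD z hz).1)
  have hΨsrc : ∀ z ∈ D, Ψ z ∈ φ.source := fun z hz => φ.map_target (hρt (hD z hz).1)
  have hΘΨ : ∀ z ∈ D, Θ (Ψ z) = z := by
    intro z hz
    simp [Θ, hφΨ z hz]
  have hΨlip : LipschitzOnWith K Ψ D := by
    intro z hz z' hz'
    refine (hup _ (hD z hz).1 _ (hD z' hz').1).trans (le_of_eq ?_)
    simp [edist_add_left]
  have hΘlip : LipschitzOnWith K Θ (Ψ '' D) := by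
    rintro _ ⟨z, hz, rfl⟩ _ ⟨z', hz', rfl⟩
    refine le_trans (le_of_eq ?_) (hlow _ (hδW (hD z hz).2).1 _ (hδW (hD z' hz').2).1)
    simp [Θ, edist_sub_right]
    rfl
  have hsub : ∀ r ≤ r₀, halfBall ℓ r ⊆ D := fun r hr z hz => ⟨hz.1.le.trans hr, hz.2⟩
  have himage : ∀ r ≤ r₀, Ψ '' halfBall ℓ r = φ.source ∩ φ ⁻¹' {y | ‖A y - A c‖ < r} := by
    intro r hr
    ext p
    constructor
    · rintro ⟨z, hz, rfl⟩
      refine ⟨hΨsrc z (hsub r hr hz), ?_⟩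
      rw [mem_preimage, mem_ofPred_eq, hφΨ z (hsub r hr hz)]
      simpa using hz.1
    · rintro ⟨hp, hpr⟩
      refine ⟨Θ p, ⟨?_, ?_⟩, ?_⟩
      · simpa [Θ] using hpr
      · rw [hℓ]
        have h1 : φ p ∈ range (𝓡∂ n) := extChartAt_target_subset_range x (φ.map_source hp)
        rw [range_modelWithCornersEuclideanHalfSpace, mem_ofPred_eq] at h1
        simpa [Θ, hc0] using h1
      · simp [Ψ, Θ, φ.left_inv hp]
  refine ⟨r₀, hr₀pos, Ψ, Θ, hΨlip, hΘlip, fun z hz hz' =>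
    ⟨hΘΨ z ⟨hz, hz'⟩, (hδW (hD z ⟨hz, hz'⟩).2).2⟩, fun r hr hrr₀ => ?_⟩
  have hopen : IsOpen (Ψ '' halfBall ℓ r) := by
    rw [himage r hrr₀]
    exact (continuousOn_extChartAt x).isOpen_inter_preimage (isOpen_extChartAt_source x)
      (isOpen_lt (by fun_prop) continuous_const)
  let D' : Set (EuclideanSpace ℝ (Fin n)) := {z | ‖z‖ ≤ r ∧ 0 ≤ ℓ z}
  have hD'D : D' ⊆ D := fun z hz => ⟨hz.1.trans hrr₀, hz.2⟩
  have hcompact : IsCompact (Ψ '' D') := by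
    refine IsCompact.image_of_continuousOn ?_ (hΨlip.continuousOn.mono hD'D)
    have : D' = Metric.closedBall 0 r ∩ {z | 0 ≤ ℓ z} := by ext z; simp [D']
    rw [this]
    exact (isCompact_closedBall _ _).inter_right (isClosed_le continuous_const ℓ.continuous)
  have hclosure : closure (Ψ '' halfBall ℓ r) ⊆ Ψ '' D' :=
    closure_minimal (image_mono fun z hz => ⟨hz.1.le, hz.2⟩) hcompact.isClosed
  refine ⟨hopen, ?_, ?_⟩
  · refine hasFinitePerimeter_of_ellipsoid x A (A c) hr ?_ fun p hp => ?_
    · refine hclosure.trans ?_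
      rintro _ ⟨z, hz, rfl⟩
      exact hΨsrc z (hD'D hz)
    · rw [himage r hrr₀]
      exact ⟨fun h => h.2, fun h => ⟨hp, h⟩⟩
  · refine (reducedBoundary_subset_frontier _).trans ?_
    rw [hopen.frontier_eq]
    rintro p ⟨hp, hp'⟩
    obtain ⟨z, hz, rfl⟩ := hclosure hp
    refine ⟨z, ⟨hz.1.antisymm (not_lt.1 fun h => hp' ⟨z, ⟨h, hz.2⟩, rfl⟩), hz.2⟩, rfl⟩

end HalfBall

/-! ### The profile for small volumes -/

section Profile

/-- An intermediate value property: a monotone function of the radius that is bounded on shells by a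
multiple of their Euclidean volume takes all small positive values. -/
lemma exists_eq_of_shell_bound {f : ℝ → ℝ≥0∞} {C : ℝ≥0∞} {r₀ : ℝ} {n : ℕ} (hC : C ≠ ⊤)
    (hr₀ : 0 ≤ r₀) (hf0 : f 0 = 0)
    (hmono : ∀ s t, 0 ≤ s → s ≤ t → t ≤ r₀ → f s ≤ f t)
    (hshell : ∀ s t, 0 ≤ s → s ≤ t → t ≤ r₀ → f t ≤ f s + C * ENNReal.ofReal (t ^ n - s ^ n))
    {v : ℝ} (hv : 0 < v) (hv' : ENNReal.ofReal v ≤ f r₀) :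
    ∃ r, 0 < r ∧ r ≤ r₀ ∧ f r = ENNReal.ofReal v := by
  have hCt : ∀ s t : ℝ, C * ENNReal.ofReal (t ^ n - s ^ n) ≠ ⊤ := fun s t =>
    ENNReal.mul_ne_top hC ENNReal.ofReal_ne_top
  have hfin : ∀ t, 0 ≤ t → t ≤ r₀ → f t ≠ ⊤ := fun t ht ht' => by
    refine ne_top_of_le_ne_top ?_ (hshell 0 t le_rfl ht ht')
    rw [hf0, zero_add]
    exact hCt _ _
  have hbound : ∀ s t, 0 ≤ s → s ≤ t → t ≤ r₀ →
      |(f t).toReal - (f s).toReal| ≤ C.toReal * |t ^ n - s ^ n| := by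
    intro s t hs hst ht
    have h1 := ENNReal.toReal_mono (hfin t (hs.trans hst) ht) (hmono s t hs hst ht)
    have h2 := ENNReal.toReal_mono (ENNReal.add_ne_top.2 ⟨hfin s hs (hst.trans ht), hCt s t⟩)
      (hshell s t hs hst ht)
    have hpow : 0 ≤ t ^ n - s ^ n := sub_nonneg.2 (pow_le_pow_left₀ hs hst n)
    rw [ENNReal.toReal_add (hfin s hs (hst.trans ht)) (hCt s t), ENNReal.toReal_mul,
      ENNReal.toReal_ofReal hpow] at h2
    rw [abs_of_nonneg (sub_nonneg.2 h1), abs_of_nonneg hpow]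
    linarith
  have hcont : ContinuousOn (fun r => (f r).toReal) (Icc 0 r₀) := by
    intro s hs
    rw [ContinuousWithinAt, tendsto_iff_dist_tendsto_zero]
    have hlim : Tendsto (fun t : ℝ => C.toReal * |t ^ n - s ^ n|) (𝓝[Icc 0 r₀] s) (𝓝 0) := by
      have : Continuous (fun t : ℝ => C.toReal * |t ^ n - s ^ n|) := by fun_prop
      have h := this.tendsto s
      simp only [sub_self, abs_zero, mul_zero] at h
      exact h.mono_left nhdsWithin_le_nhds
    refine squeeze_zero' (Eventually.of_forall fun _ => dist_nonneg) ?_ hlim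
    filter_upwards [self_mem_nhdsWithin] with t ht
    rw [Real.dist_eq]
    rcases le_total s t with h | h
    · exact hbound s t hs.1 h ht.2
    · rw [abs_sub_comm, abs_sub_comm (t ^ n)]
      exact hbound t s ht.1 h hs.2
  have hmem : v ∈ Icc (f 0).toReal (f r₀).toReal := by
    refine ⟨by simp [hf0, hv.le], ?_⟩
    exact (ENNReal.ofReal_le_iff_le_toReal (hfin r₀ hr₀ le_rfl)).1 hv'
  obtain ⟨r, hr, hrv⟩ := intermediate_value_Icc hr₀ hcont hmem
  simp only at hrv
  refine ⟨r, hr.1.lt_of_ne ?_, hr.2, ?_⟩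
  · rintro rfl
    simp [hf0] at hrv
    exact hv.ne hrv
  · rw [← hrv, ENNReal.ofReal_toReal (hfin r hr.1 hr.2)]

/-- Elimination of the radius `r` from a lower bound `r ^ n * V / K ^ n ≤ v` for the volume and an
upper bound `K ^ n * r ^ (n - 1) * n * V` for the area `P`. -/
lemma ofReal_rpow_mul_le {n : ℕ} (hn : 0 < n) {K v r : ℝ} {V P : ℝ≥0∞} (hK : 0 < K) (hv : 0 < v)
    (hr : 0 < r) (hV0 : V ≠ 0) (hVtop : V ≠ ⊤)
    (hvol : ENNReal.ofReal (r ^ n) * V ≤ ENNReal.ofReal (K ^ n) * ENNReal.ofReal v)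
    (hP : P ≤ ENNReal.ofReal (K ^ n) * (ENNReal.ofReal (r ^ (n - 1)) * (n * V))) :
    ENNReal.ofReal (v ^ (-(((n : ℝ) - 1) / (n : ℝ)))) * P ≤
      ENNReal.ofReal (K ^ n * K ^ (n - 1)) * (n * V ^ (1 / (n : ℝ))) := by
  set W := V.toReal with hW
  have hW0 : 0 < W := ENNReal.toReal_pos hV0 hVtop
  have hVW : V = ENNReal.ofReal W := (ENNReal.ofReal_toReal hVtop).symm
  have hn' : (0 : ℝ) < n := by exact_mod_cast hn
  rw [hVW, ← ENNReal.ofReal_mul (by positivity), ← ENNReal.ofReal_mul (by positivity),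
    ENNReal.ofReal_le_ofReal_iff (by positivity)] at hvol
  set q := ((n : ℝ) - 1) / n with hq
  have hn1 : ((n - 1 : ℕ) : ℝ) = n - 1 := by rw [Nat.cast_sub hn, Nat.cast_one]
  have hq0 : 0 ≤ q := div_nonneg (by rw [← hn1]; positivity) hn'.le
  have hnq : (n : ℝ) * q = (n - 1 : ℕ) := by rw [hq, hn1]; field_simp
  have hpow : ∀ {a : ℝ}, 0 < a → (a ^ n) ^ q = a ^ (n - 1) := fun {a} ha => by
    rw [← Real.rpow_natCast a n, ← Real.rpow_mul ha.le, hnq, Real.rpow_natCast]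
  have h1 : r ^ (n - 1) * W ^ q ≤ K ^ (n - 1) * v ^ q := by
    have := Real.rpow_le_rpow (by positivity) hvol hq0
    rwa [Real.mul_rpow (by positivity) hW0.le, Real.mul_rpow (by positivity) hv.le, hpow hr,
      hpow hK] at this
  have hWq : W = W ^ q * W ^ (1 / (n : ℝ)) := by
    rw [← Real.rpow_add hW0, hq, ← add_div, sub_add_cancel, div_self hn'.ne', Real.rpow_one]
  have hvq : v ^ (-q) * v ^ q = 1 := by rw [← Real.rpow_add hv]; simp
  calc _ ≤ ENNReal.ofReal (v ^ (-q)) *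
        (ENNReal.ofReal (K ^ n) * (ENNReal.ofReal (r ^ (n - 1)) * (n * V))) := by gcongr
    _ = ENNReal.ofReal (v ^ (-q) * (K ^ n * (r ^ (n - 1) * (n * W)))) := by
      rw [hVW, ← ENNReal.ofReal_natCast, ← ENNReal.ofReal_mul (by positivity),
        ← ENNReal.ofReal_mul (by positivity), ← ENNReal.ofReal_mul (by positivity),
        ← ENNReal.ofReal_mul (by positivity)]
    _ ≤ ENNReal.ofReal (K ^ n * K ^ (n - 1) * (n * W ^ (1 / (n : ℝ)))) := by
      refine ENNReal.ofReal_le_ofReal ?_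
      calc v ^ (-q) * (K ^ n * (r ^ (n - 1) * (n * W)))
          = v ^ (-q) * K ^ n * n * W ^ (1 / (n : ℝ)) * (r ^ (n - 1) * W ^ q) := by
            nth_rewrite 1 [hWq]; ring
        _ ≤ v ^ (-q) * K ^ n * n * W ^ (1 / (n : ℝ)) * (K ^ (n - 1) * v ^ q) := by gcongr
        _ = K ^ n * K ^ (n - 1) * (n * W ^ (1 / (n : ℝ))) * (v ^ (-q) * v ^ q) := by ring
        _ = _ := by rw [hvq, mul_one]
    _ = _ := by
      rw [hVW, ← ENNReal.ofReal_natCast, ENNReal.ofReal_rpow_of_pos hW0,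
        ← ENNReal.ofReal_mul (by positivity), ← ENNReal.ofReal_mul (by positivity)]

variable {n : ℕ} [NeZero n] {M : Type*} [MetricSpace M] [MeasurableSpace M] [BorelSpace M]
  [ChartedSpace (EuclideanHalfSpace n) M] [IsManifold (𝓡∂ n) ∞ M]
  [RiemannianBundle (fun p : M => TangentSpace (𝓡∂ n) p)]
  [IsContMDiffRiemannianBundle (𝓡∂ n) ∞ (EuclideanSpace ℝ (Fin n))
    (fun p : M => TangentSpace (𝓡∂ n) p)]
  [IsRiemannianManifold (𝓡∂ n) M]

/-- The bound for small volumes up to a factor `K ^ (2 * n - 1)`, with `K > 1` arbitrary: of the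
half-balls around `x` on which `w ^ α` and `w ^ θ` are at most `K`, the one of weighted volume `v`
is a competitor for the profile. -/
lemma eventually_profile_le {θ : ℝ} (hα : 0 ≤ 2 * θ / ((n : ℝ) - 1))
    {w : M → ℝ} (hw : Continuous w) (hw1 : ∀ p, 1 ≤ w p) {x : M}
    (hx : x ∈ (𝓡∂ n).boundary M) (hwx : w x = 1) {K : ℝ≥0} (hK : 1 < K) :
    ∀ᶠ v : ℝ in 𝓝[>] 0, ENNReal.ofReal (v ^ (-(((n : ℝ) - 1) / (n : ℝ)))) * profile n θ w v ≤
      ENNReal.ofReal ((K : ℝ) ^ n * (K : ℝ) ^ (n - 1)) * (n *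
        (volume {y : EuclideanSpace ℝ (Fin n) | ‖y‖ < 1 ∧ 0 < y 0}) ^ (1 / (n : ℝ))) := by
  obtain ⟨ℓ, hℓ, hpar⟩ := exists_halfBall_parametrization hx
  have hn : 0 < n := Nat.pos_of_ne_zero (NeZero.ne n)
  have hK1 : (1 : ℝ) < K := by exact_mod_cast hK
  have hK0 : (0 : ℝ) < K := zero_lt_one.trans hK1
  set α := 2 * θ / ((n : ℝ) - 1) with hαdef
  have hwev : ∀ β : ℝ, ∀ᶠ p in 𝓝 x, w p ^ β ≤ K := fun β => by
    have hc : ContinuousAt (fun p => w p ^ β) x :=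
      hw.continuousAt.rpow_const (Or.inl (by rw [hwx]; exact one_ne_zero))
    have h1 : w x ^ β < K := by rw [hwx, Real.one_rpow]; exact hK1
    exact (hc.eventually_lt_const h1).mono fun p hp => hp.le
  obtain ⟨r₀, hr₀, Ψ, Θ, hΨ, hΘ, hΨΘ, hset⟩ := hpar K hK _ ((hwev α).and (hwev θ))
  let D : Set (EuclideanSpace ℝ (Fin n)) := {z | ‖z‖ ≤ r₀ ∧ 0 ≤ ℓ z}
  let ℓ' : EuclideanSpace ℝ (Fin n) →L[ℝ] ℝ := EuclideanSpace.proj 0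
  have hℓ' : ℓ' ≠ 0 := fun h => by
    have : ℓ' (EuclideanSpace.single 0 1) = 0 := by rw [h]; rfl
    simp [ℓ'] at this
  set V := volume {y : EuclideanSpace ℝ (Fin n) | ‖y‖ < 1 ∧ 0 < y 0} with hV
  have hV2 : 2 * V = volume (Metric.ball (0 : EuclideanSpace ℝ (Fin n)) 1) :=
    two_mul_volume_pos_halfBall hℓ' 1
  have hV0 : V ≠ 0 := by
    intro h
    rw [h, mul_zero] at hV2
    exact (Metric.measure_ball_pos volume (0 : EuclideanSpace ℝ (Fin n)) one_pos).ne hV2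
  have hVtop : V ≠ ⊤ := by
    refine ne_top_of_le_ne_top (b := 2 * V) ?_ (le_mul_of_one_le_left zero_le one_le_two)
    rw [hV2]
    exact measure_ball_lt_top.ne
  have hvolHE : (μHE[n] : Measure (EuclideanSpace ℝ (Fin n))) = volume :=
    EuclideanSpace.euclideanHausdorffMeasure_eq_volume n
  have hsub : ∀ r ≤ r₀, halfBall ℓ r ⊆ D := fun r hr z hz => ⟨hz.1.le.trans hr, hz.2⟩
  have hE0 : Ψ '' halfBall ℓ 0 = ∅ := by
    rw [image_eq_empty, eq_empty_iff_forall_notMem]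
    exact fun z hz => (norm_nonneg z).not_gt hz.1
  have hopen : ∀ r, 0 ≤ r → r ≤ r₀ → IsOpen (Ψ '' halfBall ℓ r) := fun r hr hr' => by
    rcases hr.eq_or_lt with rfl | hr
    · rw [hE0]; exact isOpen_empty
    · exact (hset r hr hr').1
  have hKofReal : ∀ k : ℕ, ENNReal.ofReal ((K : ℝ) ^ k) = (K : ℝ≥0∞) ^ k := fun k => by
    rw [ENNReal.ofReal_pow hK0.le, ENNReal.ofReal_coe_nnreal]
  -- lower bound for the weighted volume of the half-balls
  have hlower : ∀ r, 0 < r → r ≤ r₀ → ENNReal.ofReal (r ^ n) * V ≤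
      ENNReal.ofReal ((K : ℝ) ^ n) * weightedVolume n α w (Ψ '' halfBall ℓ r) := by
    intro r hr hr'
    have h1 : halfBall ℓ r ⊆ Θ '' (Ψ '' halfBall ℓ r) := fun z hz =>
      ⟨Ψ z, mem_image_of_mem _ hz, (hΨΘ z (hsub r hr' hz).1 hz.2).1⟩
    have h2 := (hΘ.mono (image_mono (hsub r hr'))).euclideanHausdorffMeasure_image_le n
    have h3 : volume (halfBall ℓ r) = ENNReal.ofReal (r ^ n) * V := by
      rw [volume_halfBall hℓ hℓ' hr.le, finrank_euclideanSpace_fin]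
      rfl
    rw [hKofReal, ← h3, ← hvolHE]
    refine (measure_mono h1).trans (h2.trans ?_)
    gcongr
    rw [weightedVolume, ← setLIntegral_one]
    refine lintegral_mono fun p => ?_
    rw [ENNReal.one_le_ofReal]
    exact Real.one_le_rpow (hw1 p) hα
  -- the weighted volume depends continuously on the radius
  have hmono : ∀ s t, 0 ≤ s → s ≤ t → t ≤ r₀ →
      weightedVolume n α w (Ψ '' halfBall ℓ s) ≤ weightedVolume n α w (Ψ '' halfBall ℓ t) :=
    fun s t _ hst _ => lintegral_mono_set (image_mono fun z hz => ⟨hz.1.trans_le hst, hz.2⟩)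
  have hshell : ∀ s t, 0 ≤ s → s ≤ t → t ≤ r₀ →
      weightedVolume n α w (Ψ '' halfBall ℓ t) ≤ weightedVolume n α w (Ψ '' halfBall ℓ s) +
        K * ((K : ℝ≥0∞) ^ n * volume (Metric.ball (0 : EuclideanSpace ℝ (Fin n)) 1)) *
          ENNReal.ofReal (t ^ n - s ^ n) := by
    intro s t hs hst ht
    set S := Ψ '' halfBall ℓ t \ Ψ '' halfBall ℓ s with hS
    have hSm : MeasurableSet S := (hopen t (hs.trans hst) ht).measurableSet.diff
      (hopen s hs (hst.trans ht)).measurableSet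
    have hSsub : S ⊆ Ψ '' (D ∩ (Metric.ball 0 t \ Metric.ball 0 s)) := by
      rintro _ ⟨⟨z, hz, rfl⟩, hz'⟩
      exact ⟨z, ⟨hsub t ht hz, by simpa using hz.1,
        fun h => hz' ⟨z, ⟨by simpa using h, hz.2⟩, rfl⟩⟩, rfl⟩
    have hμS : μHE[n] S ≤ (K : ℝ≥0∞) ^ n * (ENNReal.ofReal (t ^ n - s ^ n) *
        volume (Metric.ball (0 : EuclideanSpace ℝ (Fin n)) 1)) := by
      have h1 := addHaar_ball_diff_ball (volume : Measure (EuclideanSpace ℝ (Fin n))) 0 hs hst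
      rw [finrank_euclideanSpace_fin] at h1
      rw [← h1, ← hvolHE]
      refine (measure_mono hSsub).trans
        (((hΨ.mono inter_subset_left).euclideanHausdorffMeasure_image_le n).trans ?_)
      gcongr
      exact inter_subset_right
    have hint : ∫⁻ p in S, ENNReal.ofReal (w p ^ α) ∂μHE[n] ≤ K * μHE[n] S := by
      rw [← setLIntegral_const]
      refine setLIntegral_mono' hSm fun p hp => ?_
      obtain ⟨z, hz, rfl⟩ := hp.1
      rw [← ENNReal.ofReal_coe_nnreal]
      exact ENNReal.ofReal_le_ofReal (hΨΘ z (hsub t ht hz).1 hz.2).2.1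
    calc weightedVolume n α w (Ψ '' halfBall ℓ t)
        ≤ ∫⁻ p in Ψ '' halfBall ℓ s ∪ S, ENNReal.ofReal (w p ^ α) ∂μHE[n] :=
          lintegral_mono_set (by rw [hS, union_sdiff_self]; exact subset_union_right)
      _ ≤ weightedVolume n α w (Ψ '' halfBall ℓ s) +
          ∫⁻ p in S, ENNReal.ofReal (w p ^ α) ∂μHE[n] := lintegral_union_le _ _ _
      _ ≤ weightedVolume n α w (Ψ '' halfBall ℓ s) + K * ((K : ℝ≥0∞) ^ n *
          (ENNReal.ofReal (t ^ n - s ^ n) *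
            volume (Metric.ball (0 : EuclideanSpace ℝ (Fin n)) 1))) := by
          gcongr
          exact hint.trans (by gcongr)
      _ = _ := by ring
  -- upper bound for the weighted area of the half-balls
  have harea : ∀ r, 0 < r → r ≤ r₀ → weightedArea n θ w (Ψ '' halfBall ℓ r) ≤
      ENNReal.ofReal ((K : ℝ) ^ n) * (ENNReal.ofReal (r ^ (n - 1)) * (n * V)) := by
    intro r hr hr'
    have hSD : closedHalfSphere ℓ r ⊆ D := fun z hz => ⟨hz.1.trans_le hr', hz.2⟩
    have hcompact : IsCompact (closedHalfSphere ℓ r) := by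
      have : closedHalfSphere ℓ r = Metric.sphere 0 r ∩ {z | 0 ≤ ℓ z} := by
        ext z; simp [closedHalfSphere]
      rw [this]
      exact (isCompact_sphere _ _).inter_right (isClosed_le continuous_const ℓ.continuous)
    have hm : MeasurableSet (Ψ '' closedHalfSphere ℓ r) :=
      (hcompact.image_of_continuousOn (hΨ.continuousOn.mono hSD)).isClosed.measurableSet
    have h1 := euclideanHausdorffMeasure_closedHalfSphere_le hℓ hℓ' hr
    rw [finrank_euclideanSpace_fin] at h1
    calc weightedArea n θ w (Ψ '' halfBall ℓ r)
        ≤ ∫⁻ p in Ψ '' closedHalfSphere ℓ r, ENNReal.ofReal (w p ^ θ) ∂μHE[n - 1] :=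
          lintegral_mono_set (hset r hr hr').2.2
      _ ≤ K * μHE[n - 1] (Ψ '' closedHalfSphere ℓ r) := by
          rw [← setLIntegral_const]
          refine setLIntegral_mono' hm fun p hp => ?_
          obtain ⟨z, hz, rfl⟩ := hp
          rw [← ENNReal.ofReal_coe_nnreal]
          exact ENNReal.ofReal_le_ofReal (hΨΘ z (hSD hz).1 hz.2).2.2
      _ ≤ K * ((K : ℝ≥0∞) ^ (n - 1) * μHE[n - 1] (closedHalfSphere ℓ r)) := by
          gcongr
          exact (hΨ.mono hSD).euclideanHausdorffMeasure_image_le _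
      _ = ENNReal.ofReal ((K : ℝ) ^ n) * μHE[n - 1] (closedHalfSphere ℓ r) := by
          rw [hKofReal, ← mul_assoc, ← pow_succ', Nat.sub_add_cancel hn]
      _ ≤ _ := by gcongr; exact h1
  have hf0 : weightedVolume n α w (Ψ '' halfBall ℓ 0) = 0 := by
    rw [hE0, weightedVolume, setLIntegral_empty]
  have hpos : 0 < weightedVolume n α w (Ψ '' halfBall ℓ r₀) := by
    rw [pos_iff_ne_zero]
    intro h
    have h1 := hlower r₀ hr₀ le_rfl
    rw [h, mul_zero, nonpos_iff_eq_zero, mul_eq_zero, ENNReal.ofReal_eq_zero] at h1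
    exact h1.elim (fun h => (pow_pos hr₀ n).not_ge h) hV0
  have hsmall : ∀ᶠ v : ℝ in 𝓝[>] 0,
      ENNReal.ofReal v < weightedVolume n α w (Ψ '' halfBall ℓ r₀) := by
    have : Tendsto (fun v : ℝ => ENNReal.ofReal v) (𝓝[>] 0) (𝓝 (ENNReal.ofReal 0)) :=
      (ENNReal.continuous_ofReal.tendsto 0).mono_left nhdsWithin_le_nhds
    rw [ENNReal.ofReal_zero] at this
    exact this.eventually_lt_const hpos
  filter_upwards [hsmall, self_mem_nhdsWithin] with v hv hv0
  have hv0 : 0 < v := hv0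
  obtain ⟨r, hr, hr', hrv⟩ := exists_eq_of_shell_bound
    (f := fun r => weightedVolume n α w (Ψ '' halfBall ℓ r))
    (ENNReal.mul_ne_top ENNReal.coe_ne_top (ENNReal.mul_ne_top
      (ENNReal.pow_ne_top ENNReal.coe_ne_top) measure_ball_lt_top.ne))
    hr₀.le hf0 hmono hshell hv0 hv.le
  refine ofReal_rpow_mul_le hn hK0 hv0 hr hV0 hVtop ?_ ?_
  · exact hrv ▸ hlower r hr hr'
  · refine le_trans ?_ (harea r hr hr')
    exact iInf_le_of_le _ (iInf_le_of_le (hopen r hr.le hr').measurableSet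
      (iInf_le_of_le (hset r hr hr').2.1 (iInf_le_of_le hrv le_rfl)))

end Profile

end

end WeightedProfile

theorem mainTheorem6 (n : ℕ) [NeZero n] (hn : 3 ≤ n)
    {M : Type*} [MetricSpace M] [CompactSpace M] [ConnectedSpace M]
    [MeasurableSpace M] [BorelSpace M]
    [ChartedSpace (EuclideanHalfSpace n) M] [IsManifold (𝓡∂ n) ∞ M]
    [RiemannianBundle (fun p : M => TangentSpace (𝓡∂ n) p)]
    [IsContMDiffRiemannianBundle (𝓡∂ n) ∞ (EuclideanSpace ℝ (Fin n))
      (fun p : M => TangentSpace (𝓡∂ n) p)]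
    [IsRiemannianManifold (𝓡∂ n) M]
    (θ : ℝ) (hθ₀ : 0 ≤ θ) (hθ₁ : θ ≤ ((n : ℝ) - 1) / ((n : ℝ) - 2))
    (w : M → ℝ) (hw : ContMDiff (𝓡∂ n) 𝓘(ℝ, ℝ) ∞ w) (hw_pos : ∀ p, 0 < w p)
    (x : M) (hx : x ∈ (𝓡∂ n).boundary M) (hwx : w x = 1) (hw_inf : IsGLB (range w) 1) :
    limsup (fun v : ℝ => ENNReal.ofReal (v ^ (-(((n : ℝ) - 1) / (n : ℝ)))) *
        WeightedProfile.profile n θ w v) (𝓝[>] 0) ≤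
      (n : ℝ≥0∞) *
        (volume {y : EuclideanSpace ℝ (Fin n) | ‖y‖ < 1 ∧ 0 < y 0}) ^ (1 / (n : ℝ)) := by
  have hn1 : (0 : ℝ) ≤ (n : ℝ) - 1 := by
    have : (3 : ℝ) ≤ n := by exact_mod_cast hn
    linarith
  set C := (n : ℝ≥0∞) *
    (volume {y : EuclideanSpace ℝ (Fin n) | ‖y‖ < 1 ∧ 0 < y 0}) ^ (1 / (n : ℝ)) with hC
  have hlim : Tendsto (fun K : NNReal => ENNReal.ofReal ((K : ℝ) ^ n * (K : ℝ) ^ (n - 1)) * C)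
      (𝓝[>] 1) (𝓝 (1 * C)) := by
    have hcont : Continuous fun K : NNReal => ENNReal.ofReal ((K : ℝ) ^ n * (K : ℝ) ^ (n - 1)) :=
      ENNReal.continuous_ofReal.comp (by fun_prop)
    have h1 := (hcont.tendsto 1).mono_left (nhdsWithin_le_nhds (s := Ioi 1))
    simp only [NNReal.coe_one, one_pow, mul_one, ENNReal.ofReal_one] at h1
    exact ENNReal.Tendsto.mul_const h1 (Or.inl one_ne_zero)
  rw [one_mul] at hlim
  refine ge_of_tendsto hlim ?_
  filter_upwards [self_mem_nhdsWithin] with K hK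
  exact limsup_le_of_le (by isBoundedDefault) (WeightedProfile.eventually_profile_le
    (div_nonneg (by positivity) hn1) hw.continuous (fun p => hw_inf.1 (mem_range_self p)) hx hwx hK)
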